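/- **Setting.** Let $k,N,M\ge 1$ be integers, $0\le\theta_1<\dots<\theta_k<2\pi$, $w_j=e^{i\theta_j}$, $\theta_{k+1}=\theta_1+2\pi$, $w_{k+1}=w_1$, $\beta_1,\dots,\beta_k>0$, and $V(z)=\sum_{j=0}^p(a_jz^j+\overline{a_j}z^{-j})$ with $p\ge 0$, $a_j\in\mathbb C$. For $|z|=1$ put $f(z)=e^{V(z)}\prod_{j=1}^k|z-w_j|^{\beta_j}$. Also write $f$ for its analytic continuation $f=D_i/D_e$ to $\mathbb C\setminus(\{0\}\cup\bigcup_j (0,\infty)w_j)$, where $$D_i(z)=e^{\frac{a_0+\overline{a_0}}2+\sum_{j=1}^pa_jz^j}\prod_{l=1}^k(1-zw_l^{-1})^{\beta_l/2},\qquad D_e(z)=e^{-\frac{a_0+\overline{a_0}}2-\sum_{j=1}^p\overline{a_j}z^{-j}}\prod_{l=1}^k(1-z^{-1}w_l)^{-\beta_l/2}$$ with principal powers. Let $$T_{N-1}(f)=\det\Big(\frac1M\sum_{z^M=1}z^{-(j-l)}f(z)\Big)_{j,l=0}^{N-1},\qquad \mathcal T_{N-1}(f)=\det\Big(\int_0^{2\pi}e^{-i(j-l)\theta}f(e^{i\theta})\frac{d\theta}{2\pi}\Big)_{j,l=0}^{N-1}.$$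 **Contours.** Let $\epsilon\in(0,1)$. The contour $\Gamma_j$ is the boundary of the region $\{re^{it}:1-\epsilon<r<1+\epsilon,\ \theta_j<t<\theta_{j+1}\}$. It consists of the segments $(1-\epsilon,1+\epsilon)w_j$ and $(1-\epsilon,1+\epsilon)w_{j+1}$ and of the two arcs $\{(1\pm\epsilon)e^{it}:\theta_j<t<\theta_{j+1}\}$. (If $k=1$, the two segments are the two sides of one cut and count as different parts of $\Gamma_1$.) Both the part of $\Gamma_j$ in $|z|>1$ and the part in $|z|<1$ are oriented counter-clockwise around the origin, that is, each runs from $w_j$ along the first segment to the arc, along the arc in the direction of increasing argument, and along the second segment to $w_{j+1}$. On $\Gamma_j$ let $\sigma(dz)=\frac{dz}{2\pi iz}$ for $|z|=1\pm\epsilon$ and $\sigma(dz)=\frac{dz}{2\pi z}$ for $|z|\in(1-\epsilon,1+\epsilon)$ (a real signed measure), and let $L^2(\Gamma_j,\sigma)$ be the $L^2$ space of its total variation $|\sigma|$. **Kernel.** Let $v(z)=\frac{z^M}{1-z^M}$ for $|z|<1$ and $v(z)=\frac{z^{-M}}{1-z^{-M}}$ for $|z|>1$; let $I(z)=1$ for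 $|z|=1\pm\epsilon$ and $I(z)=-i$ for $|z|\in(1-\epsilon,1+\epsilon)$. For polynomials $\phi_j$, $j\ge0$, let $\overline{\phi}_j(z)=\overline{\phi_j(\overline z)}$, and let $$K_{CD}(z,w)=\frac{\frac{w^N}{z^N}\phi_N(z)\overline{\phi}_N(w^{-1})-\overline{\phi}_N(z^{-1})\phi_N(w)}{1-\frac wz},\qquad K(z,w)=I(z)\sqrt{v(z)f(z)}\sqrt{v(w)f(w)}\,K_{CD}(z,w),$$ with principal roots, where for a variable on $\Gamma_j$ the value of $f$ is the limit from the inside of $\Gamma_j$. **Proposition.** There are polynomials $(\phi_j)_{j\ge0}$, $\deg\phi_j=j$, orthonormal with respect to $f(e^{i\theta})\frac{d\theta}{2\pi}$. For every such sequence, $$(Kh)_l(w)=\sum_{j=1}^k\int_{\Gamma_j}K(z,w)h_j(z)\,\sigma(dz)\qquad(w\in\Gamma_l)$$ (with absolutely convergent integrals for almost every $w$) defines a bounded operator $K$ on $\bigoplus_{j=1}^kL^2(\Gamma_j,\sigma)$. It has finite rank, in particular it is trace class, and $$T_{N-1}(f)=\mathcal T_{N-1}(f)\,\det(1+K)_{\bigoplus_{j=1}^kL^2(\Gamma_j,\sigma)},$$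 where $\det(1+K)$ is the Fredholm determinant. -/

import Mathlib

open MeasureTheory Set Filter Topology

noncomputable section

namespace DiscreteToeplitz

/-! ### Symbol, its continuation, and Toeplitz determinants -/

/-- The Laurent polynomial `V(z) = ∑_{j=0}^p (a_j z^j + conj(a_j) z^{-j})`. -/
def potential (p : ℕ) (a : ℕ → ℂ) (z : ℂ) : ℂ :=
  ∑ j ∈ Finset.range (p + 1), (a j * z ^ j + (starRingEnd ℂ) (a j) * z ^ (-(j : ℤ)))

/-- The point `w_j = e^{iθ_j}` of the unit circle. -/
def sing {k : ℕ} (θ : Fin k → ℝ) (j : Fin k) : ℂ := Complex.exp (θ j * Complex.I)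

/-- The Fisher-Hartwig symbol `f(z) = e^{V(z)} ∏_j |z - w_j|^{β_j}`, used on `|z| = 1`. -/
def symbol {k : ℕ} (p : ℕ) (a : ℕ → ℂ) (θ β : Fin k → ℝ) (z : ℂ) : ℂ :=
  Complex.exp (potential p a z) * ∏ j, ((‖z - sing θ j‖ ^ β j : ℝ) : ℂ)

/-- `D_i`: analytic off the rays `[1, ∞) w_l`; the powers are principal. The constant coefficient
of `V` is `a_0 + conj(a_0)`, and half of it enters here. -/
def szegoInt {k : ℕ} (p : ℕ) (a : ℕ → ℂ) (θ β : Fin k → ℝ) (z : ℂ) : ℂ :=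
  Complex.exp ((a 0 + (starRingEnd ℂ) (a 0)) / 2 + ∑ j ∈ Finset.Icc 1 p, a j * z ^ j) *
    ∏ l, (1 - z * (sing θ l)⁻¹) ^ ((β l : ℂ) / 2)

/-- `D_e`: analytic off the segments `[0, 1] w_l`; the powers are principal. -/
def szegoExt {k : ℕ} (p : ℕ) (a : ℕ → ℂ) (θ β : Fin k → ℝ) (z : ℂ) : ℂ :=
  Complex.exp (-((a 0 + (starRingEnd ℂ) (a 0)) / 2) -
      ∑ j ∈ Finset.Icc 1 p, (starRingEnd ℂ) (a j) * z ^ (-(j : ℤ))) *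
    ∏ l, (1 - z⁻¹ * sing θ l) ^ (-((β l : ℂ) / 2))

/-- The analytic continuation `D_i / D_e` of the symbol off the rays `(0, ∞) w_l`. -/
def symbolExt {k : ℕ} (p : ℕ) (a : ℕ → ℂ) (θ β : Fin k → ℝ) (z : ℂ) : ℂ :=
  szegoInt p a θ β z / szegoExt p a θ β z

/-- The discrete Toeplitz determinant
`T_{N-1}(f) = det( M⁻¹ ∑_{z^M = 1} z^{-(j-k)} f(z) )_{j,k=0}^{N-1}`. -/
def discreteToeplitz (N M : ℕ) (f : ℂ → ℂ) : ℂ :=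
  Matrix.det (Matrix.of fun j k : Fin N =>
    (1 / (M : ℂ)) * ∑ z ∈ Polynomial.nthRootsFinset M (1 : ℂ),
      z ^ (-(((j : ℕ) : ℤ) - ((k : ℕ) : ℤ))) * f z)

/-- The integral of `g` over the unit circle with respect to `dθ / 2π`. -/
def circleMean (g : ℂ → ℂ) : ℂ :=
  (1 / (2 * Real.pi) : ℂ) * ∫ t in (0 : ℝ)..(2 * Real.pi), g (Complex.exp (t * Complex.I))

/-- The Toeplitz determinant
`𝒯_{N-1}(f) = det( ∫_0^{2π} e^{-i(j-k)θ} f(e^{iθ}) dθ/2π )_{j,k=0}^{N-1}`. -/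
def toeplitz (N : ℕ) (f : ℂ → ℂ) : ℂ :=
  Matrix.det (Matrix.of fun j k : Fin N =>
    circleMean fun z => z ^ (-(((j : ℕ) : ℤ) - ((k : ℕ) : ℤ))) * f z)

/-- `φ` is a sequence of orthonormal polynomials for the weight `f(e^{iθ}) dθ/2π`, with `φ_j` of
exact degree `j`. -/
def IsOrthonormalPolys (f : ℂ → ℂ) (φ : ℕ → Polynomial ℂ) : Prop :=
  (∀ j, (φ j).degree = (j : WithBot ℕ)) ∧
  ∀ j k, circleMean (fun z => (φ j).eval z * (starRingEnd ℂ) ((φ k).eval z) * f z) =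
    if j = k then 1 else 0

/-! ### The contours

The contour `Γ_j` is written in polar coordinates `(r, t)`, `z = r e^{it}`: it is the boundary of
the rectangle `(1-ε, 1+ε) × (θ_j, θ_{j+1})`. So the two edges of a cut are different points, also
when there is only one singularity and both are edges of the same contour. -/

/-- `θ_{j+1}`, where `θ_{k+1}` is `θ_1 + 2π`. -/
def nextAngle {k : ℕ} (θ : Fin k → ℝ) (j : Fin k) : ℝ :=
  if h : (j : ℕ) + 1 < k then θ ⟨(j : ℕ) + 1, h⟩
  else θ ⟨0, lt_of_le_of_lt (Nat.zero_le _) j.isLt⟩ + 2 * Real.pi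

/-- The complex number with polar coordinates `q = (r, t)`. -/
def polar (q : ℝ × ℝ) : ℂ := q.1 * Complex.exp (q.2 * Complex.I)

/-- The inside of `Γ_j`, in polar coordinates. -/
def inside {k : ℕ} (θ : Fin k → ℝ) (ε : ℝ) (j : Fin k) : Set (ℝ × ℝ) :=
  Ioo (1 - ε) (1 + ε) ×ˢ Ioo (θ j) (nextAngle θ j)

/-- The positive measure `|σ|` on `Γ_j`: it is `dt / 2π` on both arcs and `dr / (2πr)` on both
segments. -/
def contourMeasure {k : ℕ} (θ : Fin k → ℝ) (ε : ℝ) (j : Fin k) : Measure (ℝ × ℝ) :=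
  let arc : Measure ℝ :=
    ENNReal.ofReal (1 / (2 * Real.pi)) • volume.restrict (Ioo (θ j) (nextAngle θ j))
  let seg : Measure ℝ :=
    (volume.restrict (Ioo (1 - ε) (1 + ε))).withDensity
      fun r => ENNReal.ofReal (1 / (2 * Real.pi * r))
  arc.map (fun t => (1 + ε, t)) + arc.map (fun t => (1 - ε, t)) +
    seg.map (fun r => (r, θ j)) + seg.map (fun r => (r, nextAngle θ j))

/-- The arcs `|z| = 1 ± ε` of the contours. -/
def OnArc (ε : ℝ) (q : ℝ × ℝ) : Prop := q.1 = 1 - ε ∨ q.1 = 1 + ε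

open Classical in
/-- The sign of the oriented measure `σ` relative to `|σ|`: the part of `Γ_j` with `|z| > 1` and
the part with `|z| < 1` both run counter-clockwise around the origin, from `w_j` along the first
segment to the arc, along the arc in the direction of increasing argument, and back along the
second segment to `w_{j+1}`. So `σ(dz) = dz/(2πiz)` on the arcs, `σ(dz) = dz/(2πz)` on the
segments. -/
def orientation {k : ℕ} (θ : Fin k → ℝ) (ε : ℝ) (j : Fin k) (q : ℝ × ℝ) : ℂ :=
  if OnArc ε q then 1
  else if q.2 = θ j then (if 1 < q.1 then 1 else -1)
  else (if 1 < q.1 then -1 else 1)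

open Classical in
/-- `I(z) = 1` on the arcs and `-i` on the segments. -/
def arcFactor (ε : ℝ) (q : ℝ × ℝ) : ℂ := if OnArc ε q then 1 else -Complex.I

/-- The Hilbert space `⊕_j L²(Γ_j, |σ|)`. -/
abbrev ContourSpace {k : ℕ} (θ : Fin k → ℝ) (ε : ℝ) : Type :=
  PiLp 2 fun j : Fin k => Lp ℂ 2 (contourMeasure θ ε j)

/-- The values on `Γ_j` of (the continuation of) `f`, as limits from the inside of `Γ_j`. -/
def boundaryValue {k : ℕ} (θ : Fin k → ℝ) (ε : ℝ) (f : ℂ → ℂ) (j : Fin k) : ℝ × ℝ → ℂ :=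
  extendFrom (inside θ ε j) fun q => f (polar q)

/-! ### The kernel -/

/-- `v(z) = z^M / (1 - z^M)` for `|z| < 1` and `z^{-M} / (1 - z^{-M})` for `|z| > 1`. -/
def discWeight (M : ℕ) (z : ℂ) : ℂ :=
  if ‖z‖ < 1 then z ^ M / (1 - z ^ M) else z ^ (-(M : ℤ)) / (1 - z ^ (-(M : ℤ)))

/-- The polynomial with the complex conjugate coefficients. -/
def conjPoly (P : Polynomial ℂ) : Polynomial ℂ := P.map (starRingEnd ℂ)

/-- The Christoffel-Darboux kernel (for `z ≠ w`, both nonzero). -/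
def cdKernel (N : ℕ) (φ : ℕ → Polynomial ℂ) (z w : ℂ) : ℂ :=
  (w ^ N / z ^ N * (φ N).eval z * (conjPoly (φ N)).eval w⁻¹ -
    (conjPoly (φ N)).eval z⁻¹ * (φ N).eval w) / (1 - w / z)

/-- `√(v f)` on `Γ_j`, principal branch. -/
def sqrtWeight {k : ℕ} (θ : Fin k → ℝ) (ε : ℝ) (M : ℕ) (f : ℂ → ℂ) (j : Fin k) (q : ℝ × ℝ) : ℂ :=
  (discWeight M (polar q) * boundaryValue θ ε f j q) ^ (1 / 2 : ℂ)

/-- The kernel `K(z, w) = I(z) √(v(z)f(z)) √(v(w)f(w)) K_CD(z, w)` for `z` on `Γ_j` and `w` on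
`Γ_l`. -/
def kernel {k : ℕ} (θ : Fin k → ℝ) (ε : ℝ) (N M : ℕ) (f : ℂ → ℂ) (φ : ℕ → Polynomial ℂ)
    (j l : Fin k) (z w : ℝ × ℝ) : ℂ :=
  arcFactor ε z * sqrtWeight θ ε M f j z * sqrtWeight θ ε M f l w *
    cdKernel N φ (polar z) (polar w)

/-- `K` is the integral operator with kernel `κ`:
`(K h)_l(w) = ∑_j ∫_{Γ_j} κ_{jl}(z, w) h_j(z) σ(dz)` for almost every `w` on `Γ_l`, with absolutely
convergent integrals. -/
def IsContourIntegralOperator {k : ℕ} (θ : Fin k → ℝ) (ε : ℝ)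
    (κ : Fin k → Fin k → ℝ × ℝ → ℝ × ℝ → ℂ)
    (K : ContourSpace θ ε →L[ℂ] ContourSpace θ ε) : Prop :=
  ∀ (h : ContourSpace θ ε) (l : Fin k), ∀ᵐ w ∂(contourMeasure θ ε l),
    (∀ j, Integrable (fun z => κ j l z w * (h j : ℝ × ℝ → ℂ) z * orientation θ ε j z)
      (contourMeasure θ ε j)) ∧
    (K h l : ℝ × ℝ → ℂ) w =
      ∑ j, ∫ z, κ j l z w * (h j : ℝ × ℝ → ℂ) z * orientation θ ε j z ∂(contourMeasure θ ε j)

/-! ### Trace class operators and Fredholm determinants -/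

section Fredholm

variable {H : Type*} [NormedAddCommGroup H] [InnerProductSpace ℂ H]

/-- Trace class operators of a Hilbert space, as the sums `∑_n ⟨x_n, ·⟩ y_n` with
`∑_n ‖x_n‖ ‖y_n‖ < ∞`. -/
def IsTraceClass (K : H →L[ℂ] H) : Prop :=
  ∃ x y : ℕ → H, Summable (fun n => ‖x n‖ * ‖y n‖) ∧
    ∀ h, HasSum (fun n => inner ℂ (x n) h • y n) (K h)

/-- The finite-dimensional subspaces of `H`, directed by inclusion. -/
abbrev FinDimSubspace (H : Type*) [NormedAddCommGroup H] [InnerProductSpace ℂ H] : Type _ :=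
  {F : Submodule ℂ H // FiniteDimensional ℂ F}

/-- `det(1 + P_F K P_F)` on the finite-dimensional subspace `F`, where `P_F` is the orthogonal
projection onto `F`. -/
def compressedDet (K : H →L[ℂ] H) (F : FinDimSubspace H) : ℂ :=
  haveI : FiniteDimensional ℂ F.1 := F.2
  LinearMap.det (LinearMap.id +
    ((F.1.orthogonalProjectionOnto ∘L K ∘L F.1.subtypeL : F.1 →L[ℂ] F.1) : F.1 →ₗ[ℂ] F.1))

/-- `d` is the Fredholm determinant `det(1 + K)`: the limit of the determinants of `1 + P_F K P_F`
over the finite-dimensional subspaces `F`. For trace class `K` the limit exists, since then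
`P_F K P_F → K` in trace norm; for `K` of finite rank the net is eventually constant, and its
limit is the determinant of `1 + K` on any finite-dimensional subspace that contains the range. -/
def HasFredholmDet (K : H →L[ℂ] H) (d : ℂ) : Prop :=
  Tendsto (compressedDet K) atTop (𝓝 d)

/-- The Fredholm determinant `det(1 + K)`. -/
def fredholmDet (K : H →L[ℂ] H) : ℂ := limUnder atTop (compressedDet K)

end Fredholm

end DiscreteToeplitz

end

/-! ### Orthonormal polynomials and the Christoffel-Darboux formula -/

namespace DiscreteToeplitz

open Polynomial ComplexConjugate

/-! Let `A` be the coefficient matrix of `φ_0, …, φ_{N-1}`. On `|z| = 1` one has `conj z = z⁻¹`, so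
for the average over the roots of unity and for the integral alike, the Gram matrix of these
polynomials is `conj(A) T Aᵗ`, with `T` the corresponding Toeplitz matrix (`det_gram_eq`). For the
integral the Gram matrix is the identity. Hence the discrete Toeplitz determinant is the continuous
one times the determinant of the discrete Gram matrix (`discreteToeplitz_eq_toeplitz_mul`).

The discrete Gram matrix is `1` plus the matrix of differences between the two means of `F = φ_n
conj(φ_m) f`. By Poisson summation such a difference is the sum over `m ≠ 0` of the integrals of
`z^{Mm} F` over the circle. On the circle `F` is `g f` with `g` holomorphic off `0`. The terms with
`m < 0` are moved to `|z| > 1` and those with `m > 0` to `|z| < 1`, sector by sector because the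
continuation of `f` may jump across the rays through the `w_j`. Summing the geometric series then
produces `v` (`sum_integral_discWeight`). Deforming term by term avoids the poles of `v` at the
roots of unity, which may coincide with some `w_j`. The series may be summed under the integral
because on a segment it is dominated by a multiple of `|1-r|⁻¹ |f|`, hence of `|1-r|^{β-1}`, which
is integrable for `β > 0` (`integrable_inv_mul_norm_boundaryValue`).

The Christoffel-Darboux formula writes the kernel as a sum of `N` products of a function of `z` and
a function of `w` (`kernel_eq`). So `K` is a finite-rank operator `∑ ⟨x_m, ·⟩ y_m`, and `det(1 + AB)
= det(1 + BA)` turns its Fredholm determinant into that of the matrix `1 + (⟨x_m, y_n⟩)`. Since the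
two square roots multiply to `v f`, this is the discrete Gram matrix
(`inner_leftFactor_rightFactor`). -/

lemma circleMean_congr {g h : ℂ → ℂ}
    (H : ∀ t : ℝ, g (Complex.exp (t * Complex.I)) = h (Complex.exp (t * Complex.I))) :
    circleMean g = circleMean h := by
  simp only [circleMean, H]

lemma circleMean_sum_mul {ι : Type*} (s : Finset ι) (c : ι → ℂ) (g : ι → ℂ → ℂ)
    (hg : ∀ i ∈ s, Continuous fun t : ℝ => g i (Complex.exp (t * Complex.I))) :
    circleMean (fun z => ∑ i ∈ s, c i * g i z) = ∑ i ∈ s, c i * circleMean (g i) := by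
  unfold circleMean
  beta_reduce
  rw [intervalIntegral.integral_finsetSum
    fun i hi => ((hg i hi).const_mul (c i)).intervalIntegrable _ _, Finset.mul_sum]
  refine Finset.sum_congr rfl fun i _ => ?_
  rw [intervalIntegral.integral_const_mul]
  ring

lemma exp_mul_I_ne_zero (t : ℝ) : Complex.exp (t * Complex.I) ≠ 0 := Complex.exp_ne_zero _

lemma conj_exp_mul_I (t : ℝ) :
    conj (Complex.exp (t * Complex.I)) = (Complex.exp (t * Complex.I))⁻¹ := by
  rw [← Complex.exp_conj, ← Complex.exp_neg]
  simp

lemma continuous_exp_mul_I : Continuous fun t : ℝ => Complex.exp (t * Complex.I) := by fun_prop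

lemma continuous_eval_exp (p : ℂ[X]) :
    Continuous fun t : ℝ => p.eval (Complex.exp (t * Complex.I)) :=
  p.continuous.comp continuous_exp_mul_I

lemma exists_expansion {φ : ℕ → ℂ[X]} (hφ : ∀ j, (φ j).degree = (j : WithBot ℕ)) (n : ℕ) :
    ∀ p : ℂ[X], p.degree < (n : WithBot ℕ) →
      ∃ c : ℕ → ℂ, p = ∑ j ∈ Finset.range n, C (c j) * φ j := by
  induction n with
  | zero =>
    intro p hp
    refine ⟨0, ?_⟩
    simpa [Nat.WithBot.lt_zero_iff] using hp
  | succ n ih =>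
    intro p hp
    have hlead : (φ n).coeff n ≠ 0 := by
      have := hφ n
      have h2 : (φ n).natDegree = n := natDegree_eq_of_degree_eq_some this
      nth_rw 2 [← h2]
      refine leadingCoeff_ne_zero.mpr fun h0 => ?_
      rw [h0, degree_zero] at this
      simp at this
    set d := p.coeff n / (φ n).coeff n with hd
    have hdeg : (p - C d * φ n).degree < (n : WithBot ℕ) := by
      rw [degree_lt_iff_coeff_zero]
      intro m hm
      rcases hm.eq_or_lt with rfl | hlt
      · simp [hd, hlead]
      · rw [coeff_sub, coeff_C_mul, coeff_eq_zero_of_degree_lt (p := φ n),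
          coeff_eq_zero_of_degree_lt (p := p)]
        · simp
        · refine hp.trans_le ?_
          exact_mod_cast hlt
        · rw [hφ]; exact_mod_cast hlt
    obtain ⟨c, hc⟩ := ih _ hdeg
    refine ⟨fun j => if j = n then d else c j, ?_⟩
    beta_reduce
    rw [Finset.sum_range_succ, if_pos rfl, ← sub_eq_iff_eq_add, hc]
    refine Finset.sum_congr rfl fun j hj => ?_
    rw [if_neg (Finset.mem_range.1 hj).ne]

lemma eval_reflect {n : ℕ} {p : ℂ[X]} (hp : p.natDegree ≤ n) {z : ℂ} (hz : z ≠ 0) :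
    (reflect n p).eval z = z ^ n * p.eval z⁻¹ := by
  have hz' : z⁻¹ ≠ 0 := inv_ne_zero hz
  let : Invertible z⁻¹ := invertibleOfNonzero hz'
  have := eval₂_reflect_mul_pow (RingHom.id ℂ) z⁻¹ n p hp
  rw [invOf_eq_inv, inv_inv] at this
  simp only [eval₂_id] at this
  rw [← this, inv_pow]
  field_simp

lemma eval_conjPoly (p : ℂ[X]) (z : ℂ) : (conjPoly p).eval z = conj (p.eval (conj z)) := by
  rw [conjPoly, eval_map, eval, hom_eval₂]
  simp

lemma natDegree_conjPoly (p : ℂ[X]) : (conjPoly p).natDegree = p.natDegree :=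
  natDegree_map _

/-- This replaces the conjugation in the pairing by an expression holomorphic off `0`, which contour
deformation requires. -/
lemma eval_conjPoly_inv_exp (p : ℂ[X]) (t : ℝ) :
    (conjPoly p).eval (Complex.exp (t * Complex.I))⁻¹ =
      conj (p.eval (Complex.exp (t * Complex.I))) := by
  rw [eval_conjPoly, ← conj_exp_mul_I, Complex.conj_conj]

section CD

variable {f : ℂ → ℂ} {φ : ℕ → ℂ[X]}

lemma continuous_pairing (hf : Continuous fun t : ℝ => f (Complex.exp (t * Complex.I)))
    (p q : ℂ[X]) : Continuous fun t : ℝ =>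
      p.eval (Complex.exp (t * Complex.I)) * conj (q.eval (Complex.exp (t * Complex.I))) *
        f (Complex.exp (t * Complex.I)) :=
  ((continuous_eval_exp p).mul (Complex.continuous_conj.comp (continuous_eval_exp q))).mul hf

lemma pairing_sum_left (hf : Continuous fun t : ℝ => f (Complex.exp (t * Complex.I)))
    {ι : Type*} (s : Finset ι) (c : ι → ℂ) (p : ι → ℂ[X]) (q : ℂ[X]) :
    circleMean (fun z => (∑ i ∈ s, C (c i) * p i).eval z * conj (q.eval z) * f z) =
      ∑ i ∈ s, c i * circleMean (fun z => (p i).eval z * conj (q.eval z) * f z) := by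
  rw [← circleMean_sum_mul s c _ fun i _ => continuous_pairing hf (p i) q]
  refine circleMean_congr fun t => ?_
  simp only [eval_finsetSum, eval_mul, eval_C, Finset.sum_mul]
  exact Finset.sum_congr rfl fun i _ => by ring

lemma pairing_sum_right (hf : Continuous fun t : ℝ => f (Complex.exp (t * Complex.I)))
    {ι : Type*} (s : Finset ι) (c : ι → ℂ) (p : ι → ℂ[X]) (q : ℂ[X]) :
    circleMean (fun z => q.eval z * conj ((∑ i ∈ s, C (c i) * p i).eval z) * f z) =
      ∑ i ∈ s, conj (c i) * circleMean (fun z => q.eval z * conj ((p i).eval z) * f z) := by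
  rw [← circleMean_sum_mul s (fun i => conj (c i)) _ fun i _ => continuous_pairing hf q (p i)]
  refine circleMean_congr fun t => ?_
  simp only [eval_finsetSum, eval_mul, eval_C, map_sum, map_mul, Finset.sum_mul, Finset.mul_sum]
  exact Finset.sum_congr rfl fun i _ => by ring

lemma IsOrthonormalPolys.pairing_left_eq_zero (hφ : IsOrthonormalPolys f φ)
    (hf : Continuous fun t : ℝ => f (Complex.exp (t * Complex.I))) {n : ℕ} {p : ℂ[X]}
    (hp : p.degree < (n : WithBot ℕ)) :
    circleMean (fun z => p.eval z * conj ((φ n).eval z) * f z) = 0 := by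
  obtain ⟨c, rfl⟩ := exists_expansion hφ.1 n p hp
  rw [pairing_sum_left hf]
  refine Finset.sum_eq_zero fun i hi => ?_
  rw [hφ.2, if_neg (Finset.mem_range.1 hi).ne, mul_zero]

lemma IsOrthonormalPolys.pairing_right_eq_zero (hφ : IsOrthonormalPolys f φ)
    (hf : Continuous fun t : ℝ => f (Complex.exp (t * Complex.I))) {n : ℕ} {p : ℂ[X]}
    (hp : p.degree < (n : WithBot ℕ)) :
    circleMean (fun z => (φ n).eval z * conj (p.eval z) * f z) = 0 := by
  obtain ⟨c, rfl⟩ := exists_expansion hφ.1 n p hp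
  rw [pairing_sum_right hf]
  refine Finset.sum_eq_zero fun i hi => ?_
  rw [hφ.2, if_neg (Finset.mem_range.1 hi).ne', mul_zero]

/-- The reproducing kernel of a space of polynomials does not depend on the orthonormal basis. -/
lemma sum_eval_mul_conjPoly_eq (hf : Continuous fun t : ℝ => f (Complex.exp (t * Complex.I)))
    {n : ℕ} (hφ : IsOrthonormalPolys f φ) (ψ : ℕ → ℂ[X])
    (hψ : ∀ i < n, (ψ i).degree < (n : WithBot ℕ))
    (hψo : ∀ i < n, ∀ j < n, circleMean (fun z => (ψ i).eval z * conj ((ψ j).eval z) * f z) =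
      if i = j then 1 else 0) (w u : ℂ) :
    ∑ i ∈ Finset.range n, (ψ i).eval w * (conjPoly (ψ i)).eval u =
      ∑ i ∈ Finset.range n, (φ i).eval w * (conjPoly (φ i)).eval u := by
  have hex : ∀ i : Fin n, ∃ c : ℕ → ℂ, ψ i = ∑ j ∈ Finset.range n, C (c j) * φ j :=
    fun i => exists_expansion hφ.1 n _ (hψ i i.2)
  choose c hc using hex
  let U : Matrix (Fin n) (Fin n) ℂ := Matrix.of fun i j => c i j
  have hU : U * U.conjTranspose = 1 := by
    ext i j
    have h1 := hψo i i.2 j j.2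
    rw [hc i, pairing_sum_left hf] at h1
    simp_rw [hc j, pairing_sum_right hf, hφ.2] at h1
    rw [Matrix.mul_apply, Matrix.one_apply]
    simp only [Fin.ext_iff]
    rw [← h1, Finset.sum_range]
    refine Finset.sum_congr rfl fun l _ => ?_
    simp [U]
  -- Orthonormality gives `U U* = 1`, but the kernel identity needs `U* U = 1`. The two agree
  -- because `U` is square: there are as many `ψ_i` as `φ_i`.
  have hU' : U.conjTranspose * U = 1 := mul_eq_one_comm.1 hU
  have hent : ∀ l j : Fin n, ∑ i, conj (c i l) * c i j = if l = j then 1 else 0 := by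
    intro l j
    have := congrFun (congrFun hU' l) j
    rw [Matrix.mul_apply, Matrix.one_apply] at this
    simpa [U] using this
  have e1 : ∀ i : Fin n, (ψ i).eval w = ∑ j : Fin n, c i j * (φ j).eval w := by
    intro i
    rw [hc i, eval_finsetSum, Finset.sum_range]
    simp
  have e2 : ∀ i : Fin n, (conjPoly (ψ i)).eval u =
      ∑ j : Fin n, conj (c i j) * (conjPoly (φ j)).eval u := by
    intro i
    rw [eval_conjPoly, hc i, eval_finsetSum, Finset.sum_range, map_sum]
    simp [eval_conjPoly]
  rw [Finset.sum_range, Finset.sum_range]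
  calc ∑ i : Fin n, (ψ i).eval w * (conjPoly (ψ i)).eval u
      = ∑ i : Fin n, ∑ j : Fin n, ∑ l : Fin n,
          conj (c i l) * c i j * ((φ j).eval w * (conjPoly (φ l)).eval u) := by
        refine Finset.sum_congr rfl fun i _ => ?_
        rw [e1, e2, Finset.sum_mul_sum]
        refine Finset.sum_congr rfl fun j _ => Finset.sum_congr rfl fun l _ => by ring
    _ = ∑ j : Fin n, ∑ l : Fin n, (∑ i : Fin n, conj (c i l) * c i j) *
          ((φ j).eval w * (conjPoly (φ l)).eval u) := by
        rw [Finset.sum_comm]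
        refine Finset.sum_congr rfl fun j _ => ?_
        rw [Finset.sum_comm]
        refine Finset.sum_congr rfl fun l _ => ?_
        rw [Finset.sum_mul]
    _ = _ := by
        simp_rw [hent]
        simp

lemma IsOrthonormalPolys.natDegree_eq (hφ : IsOrthonormalPolys f φ) (n : ℕ) :
    (φ n).natDegree = n := natDegree_eq_of_degree_eq_some (hφ.1 n)

lemma degree_lt_of_natDegree_lt {p : ℂ[X]} {n : ℕ} (h : p.natDegree < n) :
    p.degree < (n : WithBot ℕ) :=
  degree_le_natDegree.trans_lt (by exact_mod_cast h)

/-- The Christoffel-Darboux formula on the unit circle. -/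
lemma christoffelDarboux (hf : Continuous fun t : ℝ => f (Complex.exp (t * Complex.I)))
    (hφ : IsOrthonormalPolys f φ) {N : ℕ} {z w : ℂ} (hz : z ≠ 0) (hw : w ≠ 0) (hzw : z ≠ w) :
    cdKernel N φ z w = ∑ m ∈ Finset.range N, (conjPoly (φ m)).eval z⁻¹ * (φ m).eval w := by
  -- A second orthonormal basis of the polynomials of degree at most `N`: multiplication by `z` is
  -- isometric on the circle, and the reversed polynomial of `φ_N` spans the orthogonal complement
  -- of the multiples of `X`. Writing `S` for the sum in the claim, equality of the two reproducing
  -- kernels is a linear equation for `S`, in which `S` has the factor `1 - w/z`.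
  set ψ : ℕ → ℂ[X] := fun i => if i < N then X * φ i else reflect N (conjPoly (φ N)) with hψ
  have hdN : (conjPoly (φ N)).natDegree ≤ N := by
    rw [natDegree_conjPoly, hφ.natDegree_eq]
  have key := sum_eval_mul_conjPoly_eq hf (n := N + 1) hφ ψ ?_ ?_ w z⁻¹
  · rw [Finset.sum_range_succ, Finset.sum_range_succ] at key
    have hlast : ψ N = reflect N (conjPoly (φ N)) := by simp [hψ]
    have hsum : ∑ i ∈ Finset.range N, (ψ i).eval w * (conjPoly (ψ i)).eval z⁻¹ =
        w / z * ∑ i ∈ Finset.range N, (φ i).eval w * (conjPoly (φ i)).eval z⁻¹ := by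
      rw [Finset.mul_sum]
      refine Finset.sum_congr rfl fun i hi => ?_
      have : ψ i = X * φ i := by simp [hψ, Finset.mem_range.1 hi]
      rw [this, eval_conjPoly, eval_conjPoly]
      simp
      ring
    have hconj : (conjPoly (reflect N (conjPoly (φ N)))).eval z⁻¹ =
        (z ^ N)⁻¹ * (φ N).eval z := by
      rw [eval_conjPoly, eval_reflect hdN (by simpa using hz), eval_conjPoly]
      simp
    rw [hsum, hlast, hconj, eval_reflect hdN hw] at key
    have hne : 1 - w / z ≠ 0 := by
      rw [sub_ne_zero, ne_comm, Ne, div_eq_one_iff_eq hz]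
      exact hzw.symm
    rw [cdKernel, div_eq_iff hne]
    have hcomm : ∑ m ∈ Finset.range N, (conjPoly (φ m)).eval z⁻¹ * (φ m).eval w =
        ∑ i ∈ Finset.range N, (φ i).eval w * (conjPoly (φ i)).eval z⁻¹ :=
      Finset.sum_congr rfl fun i _ => mul_comm _ _
    rw [hcomm, div_eq_mul_inv (w ^ N)]
    linear_combination key
  · intro i hi
    by_cases hiN : i < N
    · simp only [hψ, hiN, if_true]
      refine degree_lt_of_natDegree_lt ((natDegree_mul_le).trans_lt ?_)
      rw [natDegree_X, hφ.natDegree_eq]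
      omega
    · simp only [hψ, hiN, if_false]
      refine degree_lt_of_natDegree_lt ((natDegree_reflect_le).trans_lt ?_)
      simp only [Nat.lt_succ_iff]
      exact max_le le_rfl hdN
  -- On the circle, pairing `z φ_m` with the reversed `φ_N` is the same as pairing `φ_N` with
  -- `z^{N-1} conj(φ_m)`. The latter is a polynomial of degree below `N`, so the pairing vanishes.
  · have hrefl : ∀ m < N, (reflect (N - 1) (conjPoly (φ m))).degree < (N : WithBot ℕ) := by
      intro m hm
      refine degree_lt_of_natDegree_lt ((natDegree_reflect_le).trans_lt ?_)
      rw [natDegree_conjPoly, hφ.natDegree_eq, max_lt_iff]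
      omega
    have hval : ∀ m < N, ∀ t : ℝ, (reflect (N - 1) (conjPoly (φ m))).eval
        (Complex.exp (t * Complex.I)) = Complex.exp (t * Complex.I) ^ (N - 1) *
          conj ((φ m).eval (Complex.exp (t * Complex.I))) := by
      intro m hm t
      rw [eval_reflect (by rw [natDegree_conjPoly, hφ.natDegree_eq]; omega)
        (exp_mul_I_ne_zero t), eval_conjPoly_inv_exp]
    intro i hi j hj
    by_cases hiN : i < N <;> by_cases hjN : j < N
    · rw [← hφ.2 i j]
      refine circleMean_congr fun t => ?_
      simp only [hψ, hiN, hjN, if_true, eval_mul, eval_X, map_mul, conj_exp_mul_I]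
      have := exp_mul_I_ne_zero t
      field_simp
    · obtain rfl : j = N := by omega
      rw [if_neg hiN.ne, ← hφ.pairing_right_eq_zero hf (hrefl i hiN)]
      refine circleMean_congr fun t => ?_
      rw [hval i hiN]
      simp only [hψ, hiN, if_true, lt_irrefl, if_false, eval_mul, eval_X]
      rw [eval_reflect hdN (exp_mul_I_ne_zero t), eval_conjPoly_inv_exp]
      simp only [map_mul, map_pow, Complex.conj_conj, conj_exp_mul_I, inv_pow]
      obtain ⟨n, rfl⟩ : ∃ n, j = n + 1 := ⟨j - 1, by omega⟩
      have := exp_mul_I_ne_zero t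
      simp only [Nat.add_sub_cancel]
      field_simp
      ring
    · obtain rfl : i = N := by omega
      rw [if_neg hjN.ne', ← hφ.pairing_left_eq_zero hf (hrefl j hjN)]
      refine circleMean_congr fun t => ?_
      rw [hval j hjN]
      simp only [hψ, hjN, if_true, lt_irrefl, if_false, eval_mul, eval_X]
      rw [eval_reflect hdN (exp_mul_I_ne_zero t), eval_conjPoly_inv_exp]
      simp only [map_mul, conj_exp_mul_I]
      obtain ⟨n, rfl⟩ : ∃ n, i = n + 1 := ⟨i - 1, by omega⟩
      have := exp_mul_I_ne_zero t
      simp only [Nat.add_sub_cancel]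
      field_simp
      ring
    · obtain rfl : i = N := by omega
      obtain rfl : j = i := by omega
      rw [← hφ.2 j j]
      refine circleMean_congr fun t => ?_
      simp only [hψ, lt_irrefl, if_false]
      rw [eval_reflect hdN (exp_mul_I_ne_zero t), eval_conjPoly_inv_exp]
      simp only [map_mul, map_pow, Complex.conj_conj, conj_exp_mul_I, inv_pow]
      have := exp_mul_I_ne_zero t
      field_simp

end CD

end DiscreteToeplitz

/-! ### Existence of orthonormal polynomials -/

namespace DiscreteToeplitz

open Polynomial ComplexConjugate

lemma circleMean_add {g h : ℂ → ℂ}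
    (hg : Continuous fun t : ℝ => g (Complex.exp (t * Complex.I)))
    (hh : Continuous fun t : ℝ => h (Complex.exp (t * Complex.I))) :
    circleMean (fun z => g z + h z) = circleMean g + circleMean h := by
  unfold circleMean
  beta_reduce
  rw [intervalIntegral.integral_add (hg.intervalIntegrable _ _) (hh.intervalIntegrable _ _)]
  ring

lemma circleMean_const_mul (c : ℂ) (g : ℂ → ℂ) :
    circleMean (fun z => c * g z) = c * circleMean g := by
  unfold circleMean
  beta_reduce
  rw [intervalIntegral.integral_const_mul]
  ring

lemma conj_circleMean (g : ℂ → ℂ) : conj (circleMean g) = circleMean fun z => conj (g z) := by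
  unfold circleMean
  rw [map_mul, intervalIntegral.integral_of_le Real.two_pi_pos.le,
    intervalIntegral.integral_of_le Real.two_pi_pos.le, ← integral_conj]
  congr 1
  simp [map_ofNat]

lemma circleMean_ofReal {g : ℂ → ℂ} {r : ℝ → ℝ}
    (H : ∀ t : ℝ, g (Complex.exp (t * Complex.I)) = (r t : ℂ)) :
    circleMean g = ((1 / (2 * Real.pi) * ∫ t in (0 : ℝ)..(2 * Real.pi), r t : ℝ) : ℂ) := by
  unfold circleMean
  simp_rw [H]
  rw [intervalIntegral.integral_ofReal]
  push_cast
  ring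

section Existence

variable {f : ℂ → ℂ} {ρ : ℝ → ℝ}

lemma pairing_self_eq (hρ : ∀ t : ℝ, f (Complex.exp (t * Complex.I)) = (ρ t : ℂ)) (p : ℂ[X]) :
    circleMean (fun z => p.eval z * conj (p.eval z) * f z) =
      ((1 / (2 * Real.pi) * ∫ t in (0 : ℝ)..(2 * Real.pi),
        ‖p.eval (Complex.exp (t * Complex.I))‖ ^ 2 * ρ t : ℝ) : ℂ) := by
  refine circleMean_ofReal fun t => ?_
  rw [hρ, Complex.mul_conj, Complex.normSq_eq_norm_sq]
  push_cast
  ring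

lemma infinite_circle_arc : (Complex.exp '' ((fun t : ℝ => (t : ℂ) * Complex.I) ''
    Ioo 0 (2 * Real.pi))).Infinite := by
  rw [← image_comp]
  refine Set.Infinite.image ?_ (Ioo_infinite Real.two_pi_pos)
  intro s hs t ht h
  simp only [Function.comp] at h
  rw [Complex.exp_eq_exp_iff_exists_int] at h
  obtain ⟨n, hn⟩ := h
  have h1 : (s : ℂ) = t + n * (2 * Real.pi) := by
    have : ((s : ℂ) - (t + n * (2 * Real.pi))) * Complex.I = 0 := by linear_combination hn
    rcases mul_eq_zero.1 this with h | h
    · exact sub_eq_zero.1 h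
    · exact absurd h Complex.I_ne_zero
  have h2 : s = t + n * (2 * Real.pi) := by exact_mod_cast h1
  have hpi := Real.two_pi_pos
  have hn1 : (n : ℝ) < 1 := by
    by_contra! hc
    nlinarith [hs.2, ht.1]
  have hn2 : (-1 : ℝ) < n := by
    by_contra! hc
    nlinarith [hs.1, ht.2]
  have : n = 0 := by
    have a1 : n < 1 := by exact_mod_cast hn1
    have a2 : -1 < n := by exact_mod_cast hn2
    omega
  simpa [this] using h2

/-- A continuous nonnegative integrand with integral zero vanishes. The weight has only finitely
many zeros on the circle, so `p` has infinitely many roots. -/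
lemma eq_zero_of_pairing_self_eq_zero
    (hρ : ∀ t : ℝ, f (Complex.exp (t * Complex.I)) = (ρ t : ℂ)) (hρc : Continuous ρ)
    (hρ0 : ∀ t, 0 ≤ ρ t) {S : Set ℂ} (hS : S.Finite)
    (hρS : ∀ t, ρ t = 0 → Complex.exp (t * Complex.I) ∈ S) {p : ℂ[X]}
    (hp : circleMean (fun z => p.eval z * conj (p.eval z) * f z) = 0) : p = 0 := by
  rw [pairing_self_eq hρ, Complex.ofReal_eq_zero, mul_eq_zero] at hp
  have hcont : Continuous fun t : ℝ => ‖p.eval (Complex.exp (t * Complex.I))‖ ^ 2 * ρ t :=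
    ((continuous_eval_exp p).norm.pow 2).mul hρc
  have hint := hp.resolve_left (by positivity)
  have hnn : ∀ t : ℝ, 0 ≤ ‖p.eval (Complex.exp (t * Complex.I))‖ ^ 2 * ρ t :=
    fun t => mul_nonneg (by positivity) (hρ0 t)
  have hzero : ∀ t ∈ Ioo (0 : ℝ) (2 * Real.pi),
      ‖p.eval (Complex.exp (t * Complex.I))‖ ^ 2 * ρ t = 0 := by
    intro t ht
    by_contra hne
    have hpos := intervalIntegral.integral_pos (a := 0) (b := 2 * Real.pi) Real.two_pi_pos
      hcont.continuousOn (fun x _ => hnn x) ⟨t, Ioo_subset_Icc_self ht, (hnn t).lt_of_ne' hne⟩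
    exact hpos.ne' hint
  refine p.eq_zero_of_infinite_isRoot ?_
  refine (infinite_circle_arc.sdiff hS).mono ?_
  rintro z ⟨⟨_, ⟨t, ht, rfl⟩, rfl⟩, hzS⟩
  have := hzero t ht
  rw [mul_eq_zero] at this
  rcases this with h | h
  · simpa using h
  · exact absurd (hρS t h) hzS

/-- The inner product of `L²(f dθ/2π)` on polynomials. -/
@[reducible] noncomputable def polynomialCore
    (hρ : ∀ t : ℝ, f (Complex.exp (t * Complex.I)) = (ρ t : ℂ)) (hρc : Continuous ρ)
    (hρ0 : ∀ t, 0 ≤ ρ t) {S : Set ℂ} (hS : S.Finite)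
    (hρS : ∀ t, ρ t = 0 → Complex.exp (t * Complex.I) ∈ S) : InnerProductSpace.Core ℂ ℂ[X] where
  -- The arguments are exchanged because `inner` is conjugate-linear in its first variable.
  inner p q := circleMean fun z => q.eval z * conj (p.eval z) * f z
  conj_inner_symm p q := by
    rw [conj_circleMean]
    refine circleMean_congr fun t => ?_
    simp only [map_mul, Complex.conj_conj, hρ, Complex.conj_ofReal]
    ring
  re_inner_nonneg p := by
    rw [pairing_self_eq hρ]
    simp only [RCLike.re_to_complex, Complex.ofReal_re]
    have : 0 ≤ ∫ t in (0 : ℝ)..(2 * Real.pi),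
        ‖p.eval (Complex.exp (t * Complex.I))‖ ^ 2 * ρ t :=
      intervalIntegral.integral_nonneg Real.two_pi_pos.le
        fun t _ => mul_nonneg (by positivity) (hρ0 t)
    positivity
  add_left p q r := by
    have hf : Continuous fun t : ℝ => f (Complex.exp (t * Complex.I)) := by
      simp_rw [hρ]; exact Complex.continuous_ofReal.comp hρc
    rw [← circleMean_add (continuous_pairing hf r p) (continuous_pairing hf r q)]
    refine circleMean_congr fun t => ?_
    simp only [eval_add, map_add]
    ring
  smul_left p q c := by
    rw [← circleMean_const_mul]
    refine circleMean_congr fun t => ?_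
    simp only [eval_smul, smul_eq_mul, map_mul]
    ring
  definite p hp := eq_zero_of_pairing_self_eq_zero hρ hρc hρ0 hS hρS hp

/-- Gram-Schmidt on the monomials: each step subtracts from `X^n` a polynomial of lower degree, so
the degree stays exactly `n`. -/
theorem exists_isOrthonormalPolys
    (hρ : ∀ t : ℝ, f (Complex.exp (t * Complex.I)) = (ρ t : ℂ)) (hρc : Continuous ρ)
    (hρ0 : ∀ t, 0 ≤ ρ t) {S : Set ℂ} (hS : S.Finite)
    (hρS : ∀ t, ρ t = 0 → Complex.exp (t * Complex.I) ∈ S) :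
    ∃ φ : ℕ → ℂ[X], IsOrthonormalPolys f φ := by
  let core := polynomialCore hρ hρc hρ0 hS hρS
  let : NormedAddCommGroup ℂ[X] := core.toNormedAddCommGroup
  let : InnerProductSpace ℂ ℂ[X] := InnerProductSpace.ofCore core.toCore
  let m : ℕ → ℂ[X] := fun n => X ^ n
  have hli : LinearIndependent ℂ m := by
    have := (Polynomial.basisMonomials ℂ).linearIndependent
    simpa [m, Polynomial.X_pow_eq_monomial] using this
  have horth := InnerProductSpace.gramSchmidtNormed_orthonormal hli
  have hdeg0 : ∀ n, (InnerProductSpace.gramSchmidt ℂ m n).degree = (n : WithBot ℕ) := by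
    intro n
    rw [InnerProductSpace.gramSchmidt_def]
    have hlt : (∑ i ∈ Finset.Iio n, (Submodule.span ℂ
        {InnerProductSpace.gramSchmidt ℂ m i}).starProjection (m n)).degree <
          (n : WithBot ℕ) := by
      rw [← Polynomial.mem_degreeLT]
      refine Submodule.sum_mem _ fun i hi => ?_
      have hi' := Finset.mem_Iio.1 hi
      have h1 := Submodule.starProjection_apply_mem
        (Submodule.span ℂ {InnerProductSpace.gramSchmidt ℂ m i}) (m n)
      refine (Submodule.span_le.2 ?_) h1
      rw [Set.singleton_subset_iff]
      have h2 := InnerProductSpace.gramSchmidt_mem_span ℂ m (le_refl i)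
      refine (Submodule.span_le.2 ?_) h2
      rintro _ ⟨j, hj, rfl⟩
      simp only [SetLike.mem_coe, m, Polynomial.mem_degreeLT, degree_X_pow]
      exact_mod_cast (mem_Iic.1 hj).trans_lt hi'
    rw [sub_eq_add_neg, degree_add_eq_left_of_degree_lt]
    · simp [m]
    · simpa [m] using hlt
  refine ⟨InnerProductSpace.gramSchmidtNormed ℂ m, fun n => ?_, fun j k => ?_⟩
  · rw [InnerProductSpace.gramSchmidtNormed, smul_eq_C_mul, degree_C_mul, hdeg0]
    have : InnerProductSpace.gramSchmidt ℂ m n ≠ 0 := by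
      intro h
      have := hdeg0 n
      rw [h, degree_zero] at this
      simp at this
    simpa using this
  · have := (orthonormal_iff_ite.1 horth) k j
    simp only [eq_comm (a := k)] at this
    exact this

end Existence

/-! ### Gram determinants and Toeplitz determinants -/

section Determinants

variable {f : ℂ → ℂ} {φ : ℕ → ℂ[X]}

/-- The Gram matrix of polynomials in terms of a Toeplitz matrix, for any linear mean over the
circle. -/
lemma det_gram_eq (Λ : (ℂ → ℂ) → ℂ)
    (hcongr : ∀ g h : ℂ → ℂ, (∀ z, ‖z‖ = 1 → g z = h z) → Λ g = Λ h)
    (hsum : ∀ (ι : Type) (s : Finset ι) (c : ι → ℂ) (m : ι → ℤ),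
      Λ (fun z => ∑ i ∈ s, c i * (z ^ (m i) * f z)) = ∑ i ∈ s, c i * Λ fun z => z ^ (m i) * f z)
    {N : ℕ} (hφ : ∀ n < N, (φ n).natDegree < N) :
    Matrix.det (Matrix.of fun m n : Fin N =>
      Λ fun z => (φ n).eval z * conj ((φ m).eval z) * f z) =
      conj (Matrix.det (Matrix.of fun m n : Fin N => (φ m).coeff n)) *
        Matrix.det (Matrix.of fun m n : Fin N => (φ m).coeff n) *
        Matrix.det (Matrix.of fun j l : Fin N =>
          Λ fun z => z ^ (-(((j : ℕ) : ℤ) - ((l : ℕ) : ℤ))) * f z) := by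
  set A : Matrix (Fin N) (Fin N) ℂ := Matrix.of fun m n : Fin N => (φ m).coeff n with hA
  set T : Matrix (Fin N) (Fin N) ℂ := Matrix.of fun j l : Fin N =>
          Λ fun z => z ^ (-(((j : ℕ) : ℤ) - ((l : ℕ) : ℤ))) * f z with hT
  -- Only linearity and `conj z = z⁻¹` on the circle enter, so the factorization serves both the
  -- integral and the average over the roots of unity.
  have hmat : (Matrix.of fun m n : Fin N =>
      Λ fun z => (φ n).eval z * conj ((φ m).eval z) * f z) =
      A.map (starRingEnd ℂ) * T * A.transpose := by
    ext m n
    rw [Matrix.of_apply, Matrix.mul_apply]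
    have h1 : (Λ fun z => (φ n).eval z * conj ((φ m).eval z) * f z) =
        Λ fun z => ∑ i ∈ (Finset.univ : Finset (Fin N × Fin N)),
          ((φ n).coeff i.1 * conj ((φ m).coeff i.2)) *
            (z ^ (-(((i.2 : ℕ) : ℤ) - ((i.1 : ℕ) : ℤ))) * f z) := by
      refine hcongr _ _ fun z hz => ?_
      have hz0 : z ≠ 0 := by
        rintro rfl
        simp at hz
      have hconj : conj z = z⁻¹ := by
        rw [Complex.inv_def, Complex.normSq_eq_norm_sq, hz]; simp
      rw [eval_eq_sum_range' (hφ n n.2), eval_eq_sum_range' (hφ m m.2), Finset.sum_range,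
        Finset.sum_range, map_sum, Finset.sum_mul_sum, Finset.sum_mul, ← Finset.univ_product_univ,
        Finset.sum_product]
      refine Finset.sum_congr rfl fun i _ => ?_
      rw [Finset.sum_mul]
      refine Finset.sum_congr rfl fun j _ => ?_
      rw [map_mul, map_pow, hconj, neg_sub, zpow_sub₀ hz0, zpow_natCast, zpow_natCast, inv_pow]
      field_simp
    rw [h1, hsum, ← Finset.univ_product_univ, Finset.sum_product]
    refine Finset.sum_congr rfl fun i _ => ?_
    rw [Matrix.mul_apply, Finset.sum_mul]
    refine Finset.sum_congr rfl fun j _ => ?_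
    simp only [hA, hT, Matrix.map_apply, Matrix.of_apply, Matrix.transpose_apply]
    ring
  rw [hmat, Matrix.det_mul, Matrix.det_mul, Matrix.det_transpose, ← RingHom.mapMatrix_apply,
    ← RingHom.map_det]
  ring

/-- The mean over the `M`-th roots of unity. -/
noncomputable def discreteMean (M : ℕ) (g : ℂ → ℂ) : ℂ :=
  (1 / (M : ℂ)) * ∑ z ∈ nthRootsFinset M (1 : ℂ), g z

lemma norm_eq_one_of_mem_nthRootsFinset {M : ℕ} (hM : 0 < M) {z : ℂ}
    (hz : z ∈ nthRootsFinset M (1 : ℂ)) : ‖z‖ = 1 :=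
  Complex.norm_eq_one_of_pow_eq_one ((mem_nthRootsFinset hM _).1 hz) hM.ne'

lemma exists_exp_mul_I {z : ℂ} (hz : ‖z‖ = 1) : ∃ t : ℝ, Complex.exp (t * Complex.I) = z :=
  ⟨Complex.arg z, by
    have := Complex.norm_mul_exp_arg_mul_I z
    rwa [hz, Complex.ofReal_one, one_mul] at this⟩

lemma norm_exp_mul_I (t : ℝ) : ‖Complex.exp (t * Complex.I)‖ = 1 := Complex.norm_exp_ofReal_mul_I t

lemma continuous_zpow_exp (m : ℤ) : Continuous fun t : ℝ => Complex.exp (t * Complex.I) ^ m := by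
  simp_rw [← Complex.exp_int_mul]
  fun_prop

theorem discreteToeplitz_eq_toeplitz_mul
    (hf : Continuous fun t : ℝ => f (Complex.exp (t * Complex.I)))
    (hφ : IsOrthonormalPolys f φ) {N M : ℕ} (hM : 0 < M) :
    discreteToeplitz N M f = toeplitz N f * Matrix.det (Matrix.of fun m n : Fin N =>
      discreteMean M fun z => (φ n).eval z * conj ((φ m).eval z) * f z) := by
  have hdeg : ∀ n < N, (φ n).natDegree < N := fun n hn => by rwa [hφ.natDegree_eq]
  have hc := det_gram_eq (f := f) circleMean
    (fun g h H => circleMean_congr fun t => H _ (norm_exp_mul_I t))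
    (fun ι s c m => circleMean_sum_mul s c _ fun i _ => (continuous_zpow_exp (m i)).mul hf) hdeg
  have hd := det_gram_eq (f := f) (discreteMean M)
    (fun g h H => by
      unfold discreteMean
      congr 1
      exact Finset.sum_congr rfl fun z hz => H z (norm_eq_one_of_mem_nthRootsFinset hM hz))
    (fun ι s c m => by
      unfold discreteMean
      rw [Finset.sum_comm, Finset.mul_sum]
      refine Finset.sum_congr rfl fun i _ => ?_
      rw [← Finset.mul_sum]
      ring) hdeg
  have h1 : (Matrix.of fun m n : Fin N =>
      circleMean fun z => (φ n).eval z * conj ((φ m).eval z) * f z) = 1 := by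
    ext m n
    rw [Matrix.of_apply, hφ.2, Matrix.one_apply]
    simp [Fin.ext_iff, eq_comm]
  rw [h1, Matrix.det_one] at hc
  rw [hd]
  change _ = Matrix.det (Matrix.of fun j l : Fin N =>
    circleMean fun z => z ^ (-(((j : ℕ) : ℤ) - ((l : ℕ) : ℤ))) * f z) * _
  change Matrix.det (Matrix.of fun j l : Fin N =>
    discreteMean M fun z => z ^ (-(((j : ℕ) : ℤ) - ((l : ℕ) : ℤ))) * f z) = _
  -- `hc` states that `|det A|²` times the continuous determinant is `1`. Multiplying it by the
  -- discrete determinant gives the claim without any division.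
  linear_combination (Matrix.det (Matrix.of fun j l : Fin N =>
    discreteMean M fun z => z ^ (-(((j : ℕ) : ℤ) - ((l : ℕ) : ℤ))) * f z)) * hc

end Determinants

end DiscreteToeplitz

/-! ### Boundary values of the continued symbol -/

namespace DiscreteToeplitz

open ComplexConjugate

section Powers

lemma im_one_sub_mul_exp (r s : ℝ) :
    (1 - (r : ℂ) * Complex.exp (s * Complex.I)).im = -(r * Real.sin s) := by
  rw [Complex.sub_im, Complex.im_ofReal_mul, Complex.exp_ofReal_mul_I_im, Complex.one_im, zero_sub]

lemma re_one_sub_mul_exp (r s : ℝ) :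
    (1 - (r : ℂ) * Complex.exp (s * Complex.I)).re = 1 - r * Real.cos s := by
  rw [Complex.sub_re, Complex.re_ofReal_mul, Complex.exp_ofReal_mul_I_re, Complex.one_re]

lemma one_sub_mul_exp_mem_slitPlane {r s : ℝ} (hr : 0 < r) (hs : ∀ n : ℤ, s ≠ 2 * Real.pi * n) :
    1 - (r : ℂ) * Complex.exp (s * Complex.I) ∈ Complex.slitPlane := by
  rw [Complex.mem_slitPlane_iff, im_one_sub_mul_exp, re_one_sub_mul_exp]
  by_cases h : Real.sin s = 0
  · left
    rcases Real.sin_eq_zero_iff_cos_eq.1 h with h1 | h1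
    · obtain ⟨n, hn⟩ := (Real.cos_eq_one_iff s).1 h1
      exact absurd (by rw [← hn]; ring) (hs n)
    · rw [h1]; linarith
  · right
    simp [hr.ne', h]

variable {X : Type*} {l : Filter X}

/-- Off the cut the power is continuous; at `0` it tends to `0` because `b > 0`; at a point of the
negative axis the logarithm has a limit from each side, and `him` fixes the side. -/
lemma exists_tendsto_cpow {u : X → ℂ} {c : ℂ} (hu : Tendsto u l (𝓝 c)) {b : ℝ} (hb : 0 < b)
    (him : c ∈ Complex.slitPlane ∨ (∀ᶠ x in l, (u x).im < 0) ∨ ∀ᶠ x in l, 0 < (u x).im) :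
    ∃ y, Tendsto (fun x => u x ^ (b : ℂ)) l (𝓝 y) := by
  by_cases hc : c ∈ Complex.slitPlane
  · exact ⟨_, hu.cpow tendsto_const_nhds hc⟩
  rcases eq_or_ne c 0 with rfl | hc0
  · refine ⟨0, ?_⟩
    rw [tendsto_zero_iff_norm_tendsto_zero]
    simp_rw [Complex.norm_cpow_real]
    have := (hu.norm.rpow_const (p := b) (Or.inr hb.le))
    rwa [norm_zero, Real.zero_rpow hb.ne'] at this
  have hcim : c.im = 0 := by
    by_contra h
    exact hc (Complex.mem_slitPlane_iff.2 (Or.inr h))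
  have hcre : c.re < 0 := by
    rcases lt_trichotomy c.re 0 with h | h | h
    · exact h
    · exact absurd (Complex.ext h hcim) hc0
    · exact absurd (Complex.mem_slitPlane_iff.2 (Or.inl h)) hc
  have hne : ∀ᶠ x in l, u x ≠ 0 := hu.eventually_ne hc0
  suffices h : ∃ y, Tendsto (fun x => Complex.log (u x)) l (𝓝 y) by
    obtain ⟨y, hy⟩ := h
    refine ⟨Complex.exp (y * b), ?_⟩
    refine Tendsto.congr' ?_ ((Complex.continuous_exp.tendsto _).comp (hy.mul_const (b : ℂ)))
    filter_upwards [hne] with x hx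
    rw [Complex.cpow_def_of_ne_zero hx]
    rfl
  rcases him with h | h | h
  · exact absurd h hc
  · exact ⟨_, (Complex.tendsto_log_nhdsWithin_im_neg_of_re_neg_of_im_zero hcre hcim).comp
      (tendsto_nhdsWithin_iff.2 ⟨hu, h⟩)⟩
  · exact ⟨_, (Complex.continuousWithinAt_log_of_re_neg_of_im_zero hcre hcim).tendsto.comp
      (tendsto_nhdsWithin_iff.2 ⟨hu, h.mono fun _ => le_of_lt⟩)⟩

/-- The imaginary part of `1 - r e^{is}` is `-r sin s`. Thus approaching a ray `s₀ ∈ 2πℤ` from one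
side in the angle means approaching the cut of the power from one side. -/
lemma exists_tendsto_one_sub_mul_exp_cpow {r s : X → ℝ} {r₀ s₀ : ℝ} (hr₀ : 0 < r₀)
    (hr : Tendsto r l (𝓝 r₀)) (hs : Tendsto s l (𝓝 s₀))
    (hside : (∀ n : ℤ, s₀ ≠ 2 * Real.pi * n) ∨ (∀ᶠ x in l, s₀ < s x) ∨ ∀ᶠ x in l, s x < s₀)
    {b : ℝ} (hb : 0 < b) :
    ∃ y, Tendsto (fun x => (1 - (r x : ℂ) * Complex.exp (s x * Complex.I)) ^ (b : ℂ)) l (𝓝 y) := by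
  have hu : Tendsto (fun x => 1 - (r x : ℂ) * Complex.exp (s x * Complex.I)) l
      (𝓝 (1 - (r₀ : ℂ) * Complex.exp (s₀ * Complex.I))) := by
    have h1 : Tendsto (fun x => (r x : ℂ)) l (𝓝 (r₀ : ℂ)) :=
      (Complex.continuous_ofReal.tendsto _).comp hr
    have h2 : Tendsto (fun x => Complex.exp (s x * Complex.I)) l
        (𝓝 (Complex.exp (s₀ * Complex.I))) := (continuous_exp_mul_I.tendsto _).comp hs
    exact tendsto_const_nhds.sub (h1.mul h2)
  refine exists_tendsto_cpow hu hb ?_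
  by_cases hn : ∀ n : ℤ, s₀ ≠ 2 * Real.pi * n
  · exact Or.inl (one_sub_mul_exp_mem_slitPlane hr₀ hn)
  right
  have hside' := hside.resolve_left hn
  push Not at hn
  obtain ⟨n, rfl⟩ := hn
  have hrpos : ∀ᶠ x in l, 0 < r x := hr.eventually (lt_mem_nhds hr₀)
  have hsin : ∀ x, Real.sin (s x) = Real.sin (s x - 2 * Real.pi * n) := by
    intro x
    rw [show s x - 2 * Real.pi * n = s x - n * (2 * Real.pi) by ring, Real.sin_sub_int_mul_two_pi]
  have hnear1 : ∀ᶠ x in l, s x < 2 * Real.pi * n + Real.pi :=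
    hs.eventually (gt_mem_nhds (by linarith [Real.pi_pos]))
  have hnear2 : ∀ᶠ x in l, 2 * Real.pi * n - Real.pi < s x :=
    hs.eventually (lt_mem_nhds (by linarith [Real.pi_pos]))
  rcases hside' with h | h
  · left
    filter_upwards [hrpos, hnear1, h] with x hx h1 h2
    rw [im_one_sub_mul_exp, hsin, neg_lt_zero]
    exact mul_pos hx (Real.sin_pos_of_pos_of_lt_pi (by linarith) (by linarith))
  · right
    filter_upwards [hrpos, hnear2, h] with x hx h1 h2
    rw [im_one_sub_mul_exp, hsin, neg_pos]
    exact mul_neg_of_pos_of_neg hx (Real.sin_neg_of_neg_of_neg_pi_lt (by linarith) (by linarith))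

end Powers

section Angles

variable {k : ℕ} {θ : Fin k → ℝ}

lemma nextAngle_le_of_lt (hθ : StrictMono θ) {j l : Fin k} (h : j < l) : nextAngle θ j ≤ θ l := by
  have : (j : ℕ) + 1 < k := lt_of_le_of_lt (Nat.succ_le_of_lt h) l.2
  rw [nextAngle, dif_pos this]
  exact hθ.monotone (Fin.mk_le_of_le_val (Nat.succ_le_of_lt h))

lemma nextAngle_le (hθ : StrictMono θ) (hθr : ∀ j, θ j ∈ Ico 0 (2 * Real.pi)) (j l : Fin k) :
    nextAngle θ j ≤ θ l + 2 * Real.pi := by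
  rw [nextAngle]
  split_ifs with h
  · linarith [(hθr ⟨j + 1, h⟩).2, (hθr l).1]
  · have : θ ⟨0, lt_of_le_of_lt (Nat.zero_le _) j.isLt⟩ ≤ θ l :=
      hθ.monotone (Fin.mk_le_of_le_val (Nat.zero_le _))
    linarith

lemma lt_nextAngle (hθ : StrictMono θ) (hθr : ∀ j, θ j ∈ Ico 0 (2 * Real.pi)) (j : Fin k) :
    θ j < nextAngle θ j := by
  rw [nextAngle]
  split_ifs with h
  · exact hθ (Fin.lt_def.2 (Nat.lt_succ_self _))
  · linarith [(hθr j).2, (hθr ⟨0, lt_of_le_of_lt (Nat.zero_le _) j.isLt⟩).1]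

/-- An open sector meets no cut: `t - θ_l` lies in `(-2π, 2π)`, so only `n = 0` is possible, and no
`θ_l` lies strictly between `θ_j` and the next angle. -/
lemma sub_ne_of_mem_Ioo (hθ : StrictMono θ) (hθr : ∀ j, θ j ∈ Ico 0 (2 * Real.pi)) {j : Fin k}
    {t : ℝ} (ht : t ∈ Ioo (θ j) (nextAngle θ j)) (l : Fin k) (n : ℤ) :
    t - θ l ≠ 2 * Real.pi * n := by
  intro h
  have hpi := Real.two_pi_pos
  have h1 := nextAngle_le hθ hθr j l
  have hn1 : (n : ℝ) < 1 := by
    by_contra! hc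
    nlinarith [ht.2]
  have hn2 : (-1 : ℝ) < n := by
    by_contra! hc
    nlinarith [ht.1, (hθr j).1, (hθr l).2]
  have hn : n = 0 := by
    have a1 : n < 1 := by exact_mod_cast hn1
    have a2 : -1 < n := by exact_mod_cast hn2
    omega
  subst hn
  have ht' : t = θ l := by simpa [sub_eq_zero] using h
  rw [ht'] at ht
  have := nextAngle_le_of_lt hθ (hθ.lt_iff_lt.1 ht.1)
  exact absurd ht.2 this.not_gt

lemma exists_sing_eq_exp_nextAngle (j : Fin k) :
    ∃ l, Complex.exp (nextAngle θ j * Complex.I) = sing θ l := by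
  rw [nextAngle]
  split_ifs with h
  · exact ⟨_, rfl⟩
  · refine ⟨⟨0, lt_of_le_of_lt (Nat.zero_le _) j.isLt⟩, ?_⟩
    rw [sing]
    push_cast
    rw [add_mul, Complex.exp_add, Complex.exp_two_pi_mul_I, mul_one]

lemma sing_ne_zero (l : Fin k) : sing θ l ≠ 0 := Complex.exp_ne_zero _

lemma norm_sing (l : Fin k) : ‖sing θ l‖ = 1 := Complex.norm_exp_ofReal_mul_I _

lemma polar_mul_sing_inv (q : ℝ × ℝ) (l : Fin k) :
    polar q * (sing θ l)⁻¹ = (q.1 : ℂ) * Complex.exp ((q.2 - θ l : ℝ) * Complex.I) := by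
  rw [polar, sing, ← Complex.exp_neg, mul_assoc, ← Complex.exp_add]
  congr 2
  push_cast
  ring

lemma polar_inv_mul_sing (q : ℝ × ℝ) (l : Fin k) :
    (polar q)⁻¹ * sing θ l = ((q.1⁻¹ : ℝ) : ℂ) * Complex.exp ((θ l - q.2 : ℝ) * Complex.I) := by
  rw [polar, sing, mul_inv, ← Complex.exp_neg, mul_assoc, ← Complex.exp_add, Complex.ofReal_inv]
  congr 2
  push_cast
  ring

lemma polar_ne_zero {q : ℝ × ℝ} (h : 0 < q.1) : polar q ≠ 0 :=
  mul_ne_zero (by exact_mod_cast h.ne') (Complex.exp_ne_zero _)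

lemma norm_polar {q : ℝ × ℝ} (h : 0 < q.1) : ‖polar q‖ = q.1 := by
  rw [polar, norm_mul, Complex.norm_exp_ofReal_mul_I, mul_one, Complex.norm_real,
    Real.norm_of_nonneg h.le]

lemma continuous_polar : Continuous polar := by
  unfold polar
  fun_prop

end Angles

section Symbol

variable {k : ℕ} {p : ℕ} {a : ℕ → ℂ} {θ β : Fin k → ℝ}

/-- Inverting `D_e` makes all exponents positive, so that every factor stays bounded at its zero,
and the two halves of the constant term of `V` recombine. -/
lemma symbolExt_eq (z : ℂ) : symbolExt p a θ β z = Complex.exp (potential p a z) *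
    ∏ l, ((1 - z * (sing θ l)⁻¹) ^ ((β l / 2 : ℝ) : ℂ) *
      (1 - z⁻¹ * sing θ l) ^ ((β l / 2 : ℝ) : ℂ)) := by
  rw [symbolExt, szegoInt, szegoExt, div_eq_mul_inv, mul_inv, ← Finset.prod_inv_distrib]
  simp_rw [Complex.cpow_neg, inv_inv]
  rw [← Complex.exp_neg, mul_mul_mul_comm, ← Complex.exp_add, Finset.prod_mul_distrib]
  push_cast
  congr 2
  rw [potential, Finset.sum_range_eq_add_Ico _ (by omega)]
  have : Finset.Ico 1 (p + 1) = Finset.Icc 1 p := by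
    ext; simp [Finset.mem_Ico, Finset.mem_Icc]
  rw [this, Finset.sum_add_distrib]
  simp only [pow_zero, mul_one, Nat.cast_zero, neg_zero, zpow_zero]
  ring

lemma re_one_sub_nonneg {u : ℂ} (hu : ‖u‖ = 1) : 0 ≤ (1 - u).re := by
  rw [Complex.sub_re, Complex.one_re, sub_nonneg]
  exact hu ▸ Complex.re_le_norm u

lemma inv_eq_conj_of_norm {u : ℂ} (hu : ‖u‖ = 1) : u⁻¹ = conj u := by
  rw [Complex.inv_def, Complex.normSq_eq_norm_sq, hu]; simp

/-- On the circle `1 - u⁻¹` is the conjugate of `1 - u`, whose real part is nonnegative. The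
argument is therefore not `π`, and principal powers commute with conjugation. -/
lemma one_sub_cpow_mul_one_sub_inv_cpow {u : ℂ} (hu : ‖u‖ = 1) (b : ℝ) :
    (1 - u) ^ ((b / 2 : ℝ) : ℂ) * (1 - u⁻¹) ^ ((b / 2 : ℝ) : ℂ) = ((‖1 - u‖ ^ b : ℝ) : ℂ) := by
  have harg : (1 - u).arg ≠ Real.pi := by
    rw [Ne, Complex.arg_eq_pi_iff, not_and_or]
    exact Or.inl (re_one_sub_nonneg hu).not_gt
  have hconj : (1 - u⁻¹) = conj (1 - u) := by rw [inv_eq_conj_of_norm hu]; simp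
  rw [hconj, Complex.conj_cpow _ _ harg, Complex.conj_ofReal, Complex.mul_conj,
    Complex.normSq_eq_norm_sq, Complex.norm_cpow_real, ← Real.rpow_natCast, ← Real.rpow_mul
    (norm_nonneg _)]
  congr 2
  push_cast
  ring

lemma symbolExt_eq_symbol {z : ℂ} (hz : ‖z‖ = 1) :
    symbolExt p a θ β z = symbol p a θ β z := by
  rw [symbolExt_eq, symbol]
  congr 1
  refine Finset.prod_congr rfl fun l _ => ?_
  have hu : ‖z * (sing θ l)⁻¹‖ = 1 := by rw [norm_mul, norm_inv, hz, norm_sing]; norm_num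
  have := one_sub_cpow_mul_one_sub_inv_cpow hu (β l)
  rw [mul_inv, inv_inv] at this
  rw [this]
  congr 2
  have h : z - sing θ l = -(sing θ l) * (1 - z * (sing θ l)⁻¹) := by
    have := sing_ne_zero (θ := θ) l
    field_simp
    ring
  rw [h, norm_mul, norm_neg, norm_sing, one_mul]

lemma continuousAt_potential {z : ℂ} (hz : z ≠ 0) : ContinuousAt (potential p a) z := by
  unfold potential
  refine tendsto_finsetSum _ fun j _ => ?_
  exact ((continuousAt_const.mul (continuousAt_id.pow j))).add
    (continuousAt_const.mul (continuousAt_zpow₀ z _ (Or.inl hz)))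

lemma differentiableAt_potential {z : ℂ} (hz : z ≠ 0) :
    DifferentiableAt ℂ (potential p a) z := by
  unfold potential
  refine DifferentiableAt.fun_sum fun j _ => ?_
  exact ((differentiableAt_id.pow j).const_mul _).add
    ((differentiableAt_zpow.2 (Or.inl hz)).const_mul _)

lemma conj_potential {z : ℂ} (hz : ‖z‖ = 1) : conj (potential p a z) = potential p a z := by
  unfold potential
  rw [map_sum]
  refine Finset.sum_congr rfl fun j _ => ?_
  have h1 : conj z = z⁻¹ := (inv_eq_conj_of_norm hz).symm
  rw [map_add, map_mul, map_mul, map_pow, map_zpow₀, h1, Complex.conj_conj, inv_zpow, zpow_neg,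
    inv_inv, zpow_natCast, inv_pow]
  ring

/-- The weight `f(e^{it})` as a real function. -/
noncomputable def realSymbol (p : ℕ) (a : ℕ → ℂ) (θ β : Fin k → ℝ) (t : ℝ) : ℝ :=
  Real.exp (potential p a (Complex.exp (t * Complex.I))).re *
    ∏ j, ‖Complex.exp (t * Complex.I) - sing θ j‖ ^ β j

lemma symbol_exp (t : ℝ) :
    symbol p a θ β (Complex.exp (t * Complex.I)) = (realSymbol p a θ β t : ℂ) := by
  rw [symbol, realSymbol, Complex.ofReal_mul, Complex.ofReal_exp, Complex.ofReal_prod,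
    ← Complex.conj_eq_iff_re.1 (conj_potential (norm_exp_mul_I t))]
  simp

lemma realSymbol_nonneg (t : ℝ) : 0 ≤ realSymbol p a θ β t :=
  mul_nonneg (Real.exp_pos _).le (Finset.prod_nonneg fun _ _ => by positivity)

lemma exp_mem_of_realSymbol_eq_zero {t : ℝ} (h : realSymbol p a θ β t = 0) :
    Complex.exp (t * Complex.I) ∈ Set.range (sing θ) := by
  rw [realSymbol, mul_eq_zero, Finset.prod_eq_zero_iff] at h
  obtain ⟨j, -, hj⟩ := h.resolve_left (Real.exp_pos _).ne'
  refine ⟨j, ?_⟩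
  have := (Real.rpow_eq_zero_iff_of_nonneg (norm_nonneg _)).1 hj
  exact (sub_eq_zero.1 (norm_eq_zero.1 this.1)).symm

lemma continuous_realSymbol (hβ : ∀ j, 0 < β j) : Continuous (realSymbol p a θ β) := by
  unfold realSymbol
  refine Continuous.mul ?_ ?_
  · refine Real.continuous_exp.comp (Complex.continuous_re.comp ?_)
    exact continuous_iff_continuousAt.2 fun t =>
      (continuousAt_potential (exp_mul_I_ne_zero t)).comp_of_eq
        continuous_exp_mul_I.continuousAt rfl
  · refine continuous_finsetProd _ fun j _ => ?_
    exact (continuous_exp_mul_I.sub continuous_const).norm.rpow_const fun _ => Or.inr (hβ j).le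

lemma continuous_symbol_exp (hβ : ∀ j, 0 < β j) :
    Continuous fun t : ℝ => symbol p a θ β (Complex.exp (t * Complex.I)) := by
  simp_rw [symbol_exp]
  exact Complex.continuous_ofReal.comp (continuous_realSymbol hβ)

/-- The closed polar rectangle bounded by `Γ_j`. -/
def closedInside (θ : Fin k → ℝ) (ε : ℝ) (j : Fin k) : Set (ℝ × ℝ) :=
  Icc (1 - ε) (1 + ε) ×ˢ Icc (θ j) (nextAngle θ j)

variable {ε : ℝ} {j : Fin k}

lemma closure_inside (hθ : StrictMono θ) (hθr : ∀ j, θ j ∈ Ico 0 (2 * Real.pi)) (hε : 0 < ε)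
    (j : Fin k) : closure (inside θ ε j) = closedInside θ ε j := by
  rw [inside, closedInside, closure_prod_eq, closure_Ioo (by linarith),
    closure_Ioo (lt_nextAngle hθ hθr j).ne]

/-- This gives `boundaryValue` its meaning on the whole closed rectangle, including both edges of
each cut and the points `w_j` themselves. -/
lemma exists_tendsto_symbolExt (hθ : StrictMono θ) (hθr : ∀ j, θ j ∈ Ico 0 (2 * Real.pi))
    (hβ : ∀ j, 0 < β j) (hε : ε ∈ Ioo (0 : ℝ) 1) {q : ℝ × ℝ} (hq : q ∈ closedInside θ ε j) :
    ∃ y, Tendsto (fun q => symbolExt p a θ β (polar q)) (𝓝[inside θ ε j] q) (𝓝 y) := by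
  have hq1 : 0 < q.1 := by have := hq.1.1; linarith [hε.2]
  have hfst : Tendsto (fun q : ℝ × ℝ => q.1) (𝓝[inside θ ε j] q) (𝓝 q.1) :=
    continuous_fst.continuousWithinAt
  have hsnd : Tendsto (fun q : ℝ × ℝ => q.2) (𝓝[inside θ ε j] q) (𝓝 q.2) :=
    continuous_snd.continuousWithinAt
  have hmem : ∀ᶠ x in 𝓝[inside θ ε j] q, x ∈ inside θ ε j := self_mem_nhdsWithin
  have hside : q.2 ∈ Ioo (θ j) (nextAngle θ j) ∨
      (∀ᶠ x in 𝓝[inside θ ε j] q, q.2 < x.2) ∨ ∀ᶠ x in 𝓝[inside θ ε j] q, x.2 < q.2 := by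
    rcases hq.2.1.eq_or_lt with h1 | h1
    · right; left
      filter_upwards [hmem] with x hx
      rw [← h1]; exact hx.2.1
    rcases hq.2.2.eq_or_lt with h2 | h2
    · right; right
      filter_upwards [hmem] with x hx
      rw [h2]; exact hx.2.2
    · exact Or.inl ⟨h1, h2⟩
  have hfac1 : ∀ l, ∃ y, Tendsto (fun q => (1 - polar q * (sing θ l)⁻¹) ^ ((β l / 2 : ℝ) : ℂ))
      (𝓝[inside θ ε j] q) (𝓝 y) := by
    intro l
    simp_rw [polar_mul_sing_inv]
    refine exists_tendsto_one_sub_mul_exp_cpow hq1 hfst (hsnd.sub_const _) ?_ (half_pos (hβ l))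
    refine hside.imp (fun h => sub_ne_of_mem_Ioo hθ hθr h l)
      (Or.imp (fun h => h.mono fun _ => ?_) fun h => h.mono fun _ => ?_) <;>
    simp
  have hfac2 : ∀ l, ∃ y, Tendsto (fun q => (1 - (polar q)⁻¹ * sing θ l) ^ ((β l / 2 : ℝ) : ℂ))
      (𝓝[inside θ ε j] q) (𝓝 y) := by
    intro l
    simp_rw [polar_inv_mul_sing]
    refine exists_tendsto_one_sub_mul_exp_cpow (inv_pos.2 hq1) (hfst.inv₀ hq1.ne')
      (hsnd.const_sub _) ?_ (half_pos (hβ l))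
    -- The angle is now `θ_l - t`, so the two sides of approach are exchanged.
    refine hside.imp (fun h n hn => sub_ne_of_mem_Ioo hθ hθr h l (-n) ?_)
      fun h => h.symm.imp (fun h => h.mono fun _ => ?_) fun h => h.mono fun _ => ?_
    · push_cast; linarith
    · simp
    · simp
  choose y1 hy1 using hfac1
  choose y2 hy2 using hfac2
  simp_rw [symbolExt_eq]
  refine ⟨_, Tendsto.mul ((Complex.continuous_exp.tendsto _).comp
    ((continuousAt_potential (polar_ne_zero hq1)).tendsto.comp
      continuous_polar.continuousWithinAt)) (tendsto_finsetProd _ fun l _ => (hy1 l).mul (hy2 l))⟩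

lemma continuousOn_boundaryValue (hθ : StrictMono θ) (hθr : ∀ j, θ j ∈ Ico 0 (2 * Real.pi))
    (hβ : ∀ j, 0 < β j) (hε : ε ∈ Ioo (0 : ℝ) 1) (j : Fin k) :
    ContinuousOn (boundaryValue θ ε (symbolExt p a θ β) j) (closedInside θ ε j) :=
  continuousOn_extendFrom (closure_inside hθ hθr hε.1 j).ge
    fun _ hq => exists_tendsto_symbolExt hθ hθr hβ hε hq

lemma fst_pos_of_mem_inside (hε : ε ∈ Ioo (0 : ℝ) 1) {q : ℝ × ℝ} (hq : q ∈ inside θ ε j) :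
    0 < q.1 := by have := hq.1.1; linarith [hε.2]

lemma differentiableAt_symbolExt (hθ : StrictMono θ) (hθr : ∀ j, θ j ∈ Ico 0 (2 * Real.pi))
    (hε : ε ∈ Ioo (0 : ℝ) 1) {q : ℝ × ℝ} (hq : q ∈ inside θ ε j) :
    DifferentiableAt ℂ (symbolExt p a θ β) (polar q) := by
  have hq1 := fst_pos_of_mem_inside hε hq
  have hz := polar_ne_zero hq1
  rw [show symbolExt p a θ β = _ from funext symbolExt_eq]
  refine (differentiableAt_potential hz).cexp.mul ?_
  refine DifferentiableAt.fun_finsetProd fun l _ => ?_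
  refine DifferentiableAt.mul ?_ ?_
  · refine DifferentiableAt.cpow ((differentiableAt_id.mul_const _).const_sub _)
      (differentiableAt_const _) ?_
    rw [polar_mul_sing_inv]
    exact one_sub_mul_exp_mem_slitPlane hq1 (sub_ne_of_mem_Ioo hθ hθr hq.2 l)
  · refine DifferentiableAt.cpow (((differentiableAt_inv hz).mul_const _).const_sub _)
      (differentiableAt_const _) ?_
    rw [polar_inv_mul_sing]
    refine one_sub_mul_exp_mem_slitPlane (inv_pos.2 hq1) fun n hn =>
      sub_ne_of_mem_Ioo hθ hθr hq.2 l (-n) ?_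
    push_cast
    linarith

lemma boundaryValue_eq_symbolExt (hθ : StrictMono θ) (hθr : ∀ j, θ j ∈ Ico 0 (2 * Real.pi))
    (hε : ε ∈ Ioo (0 : ℝ) 1) {q : ℝ × ℝ} (hq : q ∈ inside θ ε j) :
    boundaryValue θ ε (symbolExt p a θ β) j q = symbolExt p a θ β (polar q) := by
  refine extendFrom_eq (subset_closure hq) ?_
  exact ((differentiableAt_symbolExt hθ hθr hε hq).continuousAt.comp
    continuous_polar.continuousAt).continuousWithinAt

lemma boundaryValue_one (hθ : StrictMono θ) (hθr : ∀ j, θ j ∈ Ico 0 (2 * Real.pi))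
    (hε : ε ∈ Ioo (0 : ℝ) 1) {t : ℝ}
    (ht : t ∈ Ioo (θ j) (nextAngle θ j)) :
    boundaryValue θ ε (symbolExt p a θ β) j (1, t) =
      symbol p a θ β (Complex.exp (t * Complex.I)) := by
  have hq : ((1, t) : ℝ × ℝ) ∈ inside θ ε j :=
    ⟨⟨by linarith [hε.1], by linarith [hε.1]⟩, ht⟩
  rw [boundaryValue_eq_symbolExt hθ hθr hε hq, symbolExt_eq_symbol (norm_polar one_pos)]
  simp [polar]

lemma norm_symbolExt (z : ℂ) : ‖symbolExt p a θ β z‖ = ‖Complex.exp (potential p a z)‖ *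
    ∏ l, (‖1 - z * (sing θ l)⁻¹‖ ^ (β l / 2) * ‖1 - z⁻¹ * sing θ l‖ ^ (β l / 2)) := by
  rw [symbolExt_eq, norm_mul, norm_prod]
  simp_rw [norm_mul, Complex.norm_cpow_real]

lemma continuousAt_norm_factor (hβ : ∀ j, 0 < β j) {z : ℂ} (hz : z ≠ 0) (l : Fin k) :
    ContinuousAt (fun z => ‖1 - z * (sing θ l)⁻¹‖ ^ (β l / 2) *
      ‖1 - z⁻¹ * sing θ l‖ ^ (β l / 2)) z := by
  refine ContinuousAt.mul ?_ ?_
  · exact (continuousAt_const.sub (continuousAt_id.mul continuousAt_const)).norm.rpow_const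
      (Or.inr (half_pos (hβ l)).le)
  · exact (continuousAt_const.sub ((continuousAt_inv₀ hz).mul continuousAt_const)).norm.rpow_const
      (Or.inr (half_pos (hβ l)).le)

/-- The modulus does not jump across the cuts, since `|u^b| = |u|^b` for real `b`. It can therefore
be computed from the formula on the cut itself. -/
lemma norm_boundaryValue (hθ : StrictMono θ) (hθr : ∀ j, θ j ∈ Ico 0 (2 * Real.pi))
    (hβ : ∀ j, 0 < β j) (hε : ε ∈ Ioo (0 : ℝ) 1) {q : ℝ × ℝ} (hq : q ∈ closedInside θ ε j) :
    ‖boundaryValue θ ε (symbolExt p a θ β) j q‖ = ‖symbolExt p a θ β (polar q)‖ := by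
  have hq1 : 0 < q.1 := by have := hq.1.1; linarith [hε.2]
  have hz := polar_ne_zero hq1
  have hcl : q ∈ closure (inside θ ε j) := by rwa [closure_inside hθ hθr hε.1 j]
  have : (𝓝[inside θ ε j] q).NeBot := mem_closure_iff_nhdsWithin_neBot.1 hcl
  refine tendsto_nhds_unique (tendsto_extendFrom
    (exists_tendsto_symbolExt hθ hθr hβ hε hq)).norm ?_
  have hc : ContinuousAt (fun z => ‖symbolExt p a θ β z‖) (polar q) := by
    simp_rw [norm_symbolExt]
    exact (Complex.continuous_exp.continuousAt.comp (continuousAt_potential hz)).norm.mul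
      (tendsto_finsetProd _ fun l _ => continuousAt_norm_factor hβ hz l)
  exact hc.tendsto.comp continuous_polar.continuousWithinAt

/-- On the ray through `w_l` the two factors with index `l` have modulus `|1-r|^{β/2} |1-1/r|^{β/2}
= |1-r|^β r^{-β/2}`. All else is continuous on a compact rectangle. -/
lemma exists_norm_boundaryValue_le (hθ : StrictMono θ) (hθr : ∀ j, θ j ∈ Ico 0 (2 * Real.pi))
    (hβ : ∀ j, 0 < β j) (hε : ε ∈ Ioo (0 : ℝ) 1) (j l : Fin k) :
    ∃ C, 0 ≤ C ∧ ∀ q ∈ closedInside θ ε j, Complex.exp (q.2 * Complex.I) = sing θ l →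
      ‖boundaryValue θ ε (symbolExt p a θ β) j q‖ ≤ C * |1 - q.1| ^ β l := by
  let R : ℂ → ℝ := fun z => ‖Complex.exp (potential p a z)‖ * ∏ m ∈ Finset.univ.erase l,
    (‖1 - z * (sing θ m)⁻¹‖ ^ (β m / 2) * ‖1 - z⁻¹ * sing θ m‖ ^ (β m / 2))
  let Q : ℝ × ℝ → ℝ := fun q => R (polar q) * q.1⁻¹ ^ (β l / 2)
  have hpos : ∀ q ∈ closedInside θ ε j, 0 < q.1 := fun q hq => by
    have := hq.1.1; linarith [hε.2]
  have hQ : ContinuousOn Q (closedInside θ ε j) := by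
    intro q hq
    have hz := polar_ne_zero (hpos q hq)
    refine ContinuousAt.continuousWithinAt (ContinuousAt.mul ?_ ?_)
    · have hR : ContinuousAt R (polar q) :=
        (Complex.continuous_exp.continuousAt.comp (continuousAt_potential hz)).norm.mul
          (tendsto_finsetProd _ fun l _ => continuousAt_norm_factor hβ hz l)
      exact hR.comp continuous_polar.continuousAt
    · exact (continuousAt_fst.inv₀ (hpos q hq).ne').rpow_const (Or.inr (half_pos (hβ l)).le)
  obtain ⟨C, hC⟩ := (isCompact_Icc.prod isCompact_Icc : IsCompact
    (closedInside θ ε j)).exists_bound_of_continuousOn hQ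
  refine ⟨|C|, abs_nonneg _, fun q hq hqe => ?_⟩
  have hq0 := hpos q hq
  have hfac : ‖1 - polar q * (sing θ l)⁻¹‖ ^ (β l / 2) * ‖1 - (polar q)⁻¹ * sing θ l‖ ^ (β l / 2) =
      |1 - q.1| ^ β l * q.1⁻¹ ^ (β l / 2) := by
    have hs := sing_ne_zero (θ := θ) l
    have h1 : polar q * (sing θ l)⁻¹ = (q.1 : ℂ) := by
      rw [polar, hqe, mul_assoc, mul_inv_cancel₀ hs, mul_one]
    have h2 : (polar q)⁻¹ * sing θ l = ((q.1⁻¹ : ℝ) : ℂ) := by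
      rw [← inv_inv (sing θ l), ← mul_inv, h1, Complex.ofReal_inv]
    have h3 : 1 - q.1⁻¹ = -(1 - q.1) * q.1⁻¹ := by field_simp; ring
    rw [h1, h2, ← Complex.ofReal_one, ← Complex.ofReal_sub, ← Complex.ofReal_sub,
      Complex.norm_real, Complex.norm_real, Real.norm_eq_abs, Real.norm_eq_abs, h3, abs_mul,
      abs_neg, abs_of_pos (inv_pos.2 hq0), Real.mul_rpow (abs_nonneg _) (inv_pos.2 hq0).le,
      ← mul_assoc, ← Real.rpow_add_of_nonneg (abs_nonneg _) (half_pos (hβ l)).le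
      (half_pos (hβ l)).le, add_halves]
  have hval : ‖boundaryValue θ ε (symbolExt p a θ β) j q‖ = Q q * |1 - q.1| ^ β l := by
    rw [norm_boundaryValue hθ hθr hβ hε hq, norm_symbolExt,
      ← Finset.mul_prod_erase _ _ (Finset.mem_univ l), hfac]
    simp only [Q, R]
    ring
  rw [hval]
  have h0 : 0 ≤ |1 - q.1| ^ β l := by positivity
  exact mul_le_mul_of_nonneg_right (((le_abs_self _).trans (hC q hq)).trans (le_abs_self C)) h0

end Symbol

end DiscreteToeplitz

/-! ### Cauchy's theorem on polar rectangles -/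

namespace DiscreteToeplitz

open ComplexConjugate

lemma integral_comp_exp {r₁ r₂ : ℝ} (h₁ : 0 < r₁) (h₁₂ : r₁ ≤ r₂) {G : ℝ → ℂ}
    (hG : ContinuousOn G (Icc r₁ r₂)) :
    ∫ x in Real.log r₁..Real.log r₂, G (Real.exp x) = ∫ r in r₁..r₂, (r⁻¹ : ℝ) • G r := by
  have h₂ : 0 < r₂ := h₁.trans_le h₁₂
  have himg : Real.exp '' uIcc (Real.log r₁) (Real.log r₂) ⊆ Icc r₁ r₂ := by
    rw [uIcc_of_le (Real.log_le_log h₁ h₁₂)]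
    rintro _ ⟨x, hx, rfl⟩
    exact ⟨(Real.log_le_iff_le_exp h₁).1 hx.1, (Real.le_log_iff_exp_le h₂).1 hx.2⟩
  have := intervalIntegral.integral_deriv_smul_comp' (a := Real.log r₁) (b := Real.log r₂)
    (f := Real.exp) (f' := Real.exp) (g := fun r => (r⁻¹ : ℝ) • G r)
    (fun x _ => Real.hasDerivAt_exp x) Real.continuous_exp.continuousOn ?_
  · rw [Real.exp_log h₁, Real.exp_log h₂] at this
    rw [← this]
    refine intervalIntegral.integral_congr fun x _ => ?_
    simp only [Function.comp, smul_smul, mul_inv_cancel₀ (Real.exp_pos x).ne', one_smul]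
  · refine ContinuousOn.mono ?_ himg
    exact (continuousOn_inv₀.mono fun r hr => (h₁.trans_le hr.1).ne').smul hG

/-- Cauchy's theorem for a rectangle in polar coordinates. -/
lemma integral_boundary_polar_rect {G : ℝ × ℝ → ℂ} {g : ℂ → ℂ} {r₁ r₂ τ₁ τ₂ : ℝ} (h₁ : 0 < r₁)
    (h₁₂ : r₁ < r₂) (hτ : τ₁ < τ₂) (hc : ContinuousOn G (Icc r₁ r₂ ×ˢ Icc τ₁ τ₂))
    (hG : ∀ q ∈ Ioo r₁ r₂ ×ˢ Ioo τ₁ τ₂, G q = g (polar q))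
    (hg : ∀ q ∈ Ioo r₁ r₂ ×ˢ Ioo τ₁ τ₂, DifferentiableAt ℂ g (polar q)) :
    (∫ r in r₁..r₂, (r⁻¹ : ℝ) • G (r, τ₁)) - (∫ r in r₁..r₂, (r⁻¹ : ℝ) • G (r, τ₂)) +
      Complex.I * (∫ t in τ₁..τ₂, G (r₂, t)) - Complex.I * (∫ t in τ₁..τ₂, G (r₁, t)) = 0 := by
  have h₂ : 0 < r₂ := h₁.trans h₁₂
  have hlog := Real.log_lt_log h₁ h₁₂
  -- The substitution `z = e^ζ` turns the polar rectangle into a Euclidean one and `dz/z` into `dζ`.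
  -- On the edges only continuity of `G` matters, so boundary values from the inside are admissible.
  let F : ℂ → ℂ := fun ζ => G (Real.exp ζ.re, ζ.im)
  have key := Complex.integral_boundary_rect_eq_zero_of_continuousOn_of_differentiableOn F
    ⟨Real.log r₁, τ₁⟩ ⟨Real.log r₂, τ₂⟩ ?_ ?_
  · simp only [F, smul_eq_mul, Complex.add_re, Complex.add_im, Complex.ofReal_re,
      Complex.ofReal_im, Complex.re_ofReal_mul, Complex.im_ofReal_mul, Complex.I_re, Complex.I_im,
      mul_zero, mul_one, add_zero, zero_add, Real.exp_log h₁, Real.exp_log h₂] at key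
    rw [integral_comp_exp (G := fun r => G (r, τ₁)) h₁ h₁₂.le,
      integral_comp_exp (G := fun r => G (r, τ₂)) h₁ h₁₂.le] at key
    · exact key
    · exact hc.comp (by fun_prop) fun r hr => ⟨hr, right_mem_Icc.2 hτ.le⟩
    · exact hc.comp (by fun_prop) fun r hr => ⟨hr, left_mem_Icc.2 hτ.le⟩
  · simp only [uIcc_of_le hlog.le, uIcc_of_le hτ.le]
    refine hc.comp (Continuous.continuousOn ?_) ?_
    · exact (Real.continuous_exp.comp Complex.continuous_re).prodMk Complex.continuous_im
    · intro ζ hζ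
      rw [Complex.mem_reProdIm] at hζ
      exact ⟨⟨(Real.log_le_iff_le_exp h₁).1 hζ.1.1, (Real.le_log_iff_exp_le h₂).1 hζ.1.2⟩, hζ.2⟩
  · simp only [min_eq_left hlog.le, min_eq_left hτ.le, max_eq_right hlog.le, max_eq_right hτ.le]
    have hmem : ∀ ζ ∈ Ioo (Real.log r₁) (Real.log r₂) ×ℂ Ioo τ₁ τ₂,
        (Real.exp ζ.re, ζ.im) ∈ Ioo r₁ r₂ ×ˢ Ioo τ₁ τ₂ := by
      intro ζ hζ
      rw [Complex.mem_reProdIm] at hζ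
      exact ⟨⟨(Real.log_lt_iff_lt_exp h₁).1 hζ.1.1, (Real.lt_log_iff_exp_lt h₂).1 hζ.1.2⟩, hζ.2⟩
    have hpol : ∀ ζ : ℂ, polar (Real.exp ζ.re, ζ.im) = Complex.exp ζ := by
      intro ζ
      rw [polar, Complex.ofReal_exp, ← Complex.exp_add, Complex.re_add_im]
    have hdiff : DifferentiableOn ℂ (fun ζ => g (Complex.exp ζ))
        (Ioo (Real.log r₁) (Real.log r₂) ×ℂ Ioo τ₁ τ₂) := by
      intro ζ hζ
      have h := hg _ (hmem ζ hζ)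
      rw [hpol] at h
      exact (h.comp ζ Complex.differentiableAt_exp).differentiableWithinAt
    refine hdiff.congr fun ζ hζ => ?_
    simp only [F]
    rw [hG _ (hmem ζ hζ), hpol]

/-! ### The measure on the contours -/

section Measures

variable {k : ℕ} {θ : Fin k → ℝ} {ε : ℝ} {j : Fin k}

/-- The measure `dt / 2π` on `(θ_j, θ_{j+1})`. -/
noncomputable def arcMeasure (θ : Fin k → ℝ) (j : Fin k) : Measure ℝ :=
  ENNReal.ofReal (1 / (2 * Real.pi)) • volume.restrict (Ioo (θ j) (nextAngle θ j))

/-- The measure `dr / (2πr)` on `(1-ε, 1+ε)`. -/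
noncomputable def segMeasure (ε : ℝ) : Measure ℝ :=
  (volume.restrict (Ioo (1 - ε) (1 + ε))).withDensity
      fun r => ENNReal.ofReal (1 / (2 * Real.pi * r))

lemma contourMeasure_eq : contourMeasure θ ε j =
    (arcMeasure θ j).map (fun t => (1 + ε, t)) + (arcMeasure θ j).map (fun t => (1 - ε, t)) +
      (segMeasure ε).map (fun r => (r, θ j)) + (segMeasure ε).map (fun r => (r, nextAngle θ j)) :=
  rfl

lemma segMeasure_absolutelyContinuous : segMeasure ε ≪ volume.restrict (Ioo (1 - ε) (1 + ε)) :=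
  withDensity_absolutelyContinuous _ _

lemma arcMeasure_absolutelyContinuous :
    arcMeasure θ j ≪ volume.restrict (Ioo (θ j) (nextAngle θ j)) :=
  Measure.smul_absolutelyContinuous

/-- The radius `r = 1`, where the segment passes through a singularity and changes orientation, is a
null set and can be ignored. -/
lemma ae_segMeasure_of_forall {P : ℝ → Prop} (h : ∀ r ∈ Ioo (1 - ε) (1 + ε), r ≠ 1 → P r) :
    ∀ᵐ r ∂segMeasure ε, P r := by
  refine segMeasure_absolutelyContinuous.ae_le ((ae_restrict_iff' measurableSet_Ioo).2 ?_)
  have : ∀ᵐ r : ℝ, r ≠ 1 := by simp [ae_iff, measure_singleton]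
  filter_upwards [this] with r hr1 hr
  exact h r hr hr1

lemma ae_arcMeasure_of_forall {P : ℝ → Prop} (h : ∀ t ∈ Ioo (θ j) (nextAngle θ j), P t) :
    ∀ᵐ t ∂arcMeasure θ j, P t := by
  exact arcMeasure_absolutelyContinuous.ae_le
    ((ae_restrict_iff' measurableSet_Ioo).2 (ae_of_all _ h))

instance : IsFiniteMeasure (arcMeasure θ j) := by
  unfold arcMeasure
  exact Measure.smul_finite _ ENNReal.ofReal_ne_top

lemma isFiniteMeasure_segMeasure (hε : ε ∈ Ioo (0 : ℝ) 1) : IsFiniteMeasure (segMeasure ε) := by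
  refine isFiniteMeasure_withDensity_ofReal (Integrable.hasFiniteIntegral ?_)
  refine ContinuousOn.integrableOn_Icc (a := 1 - ε) (b := 1 + ε) ?_ |>.mono_set Ioo_subset_Icc_self
  refine continuousOn_const.div (by fun_prop) fun r hr => ?_
  have : 0 < r := by linarith [hr.1, hε.2]
  positivity

lemma measurableEmbedding_arc (c : ℝ) : MeasurableEmbedding fun t : ℝ => (c, t) :=
  measurableEmbedding_prodMk_left c

lemma measurableEmbedding_seg (c : ℝ) : MeasurableEmbedding fun r : ℝ => (r, c) :=
  measurableEmbedding_prod_mk_right c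

lemma isFiniteMeasure_contourMeasure (hε : ε ∈ Ioo (0 : ℝ) 1) :
    IsFiniteMeasure (contourMeasure θ ε j) := by
  have := isFiniteMeasure_segMeasure hε
  rw [contourMeasure_eq]
  infer_instance

lemma ae_contourMeasure_iff {P : ℝ × ℝ → Prop} : (∀ᵐ q ∂contourMeasure θ ε j, P q) ↔
    ((∀ᵐ t ∂arcMeasure θ j, P (1 + ε, t)) ∧ (∀ᵐ t ∂arcMeasure θ j, P (1 - ε, t))) ∧
      (∀ᵐ r ∂segMeasure ε, P (r, θ j)) ∧ ∀ᵐ r ∂segMeasure ε, P (r, nextAngle θ j) := by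
  rw [contourMeasure_eq, ae_add_measure_iff, ae_add_measure_iff, ae_add_measure_iff,
    (measurableEmbedding_arc _).ae_map_iff, (measurableEmbedding_arc _).ae_map_iff,
    (measurableEmbedding_seg _).ae_map_iff, (measurableEmbedding_seg _).ae_map_iff, and_assoc]

lemma integrable_contourMeasure_iff {E : Type*} [NormedAddCommGroup E] {F : ℝ × ℝ → E} :
    Integrable F (contourMeasure θ ε j) ↔
    (Integrable (fun t => F (1 + ε, t)) (arcMeasure θ j) ∧
      Integrable (fun t => F (1 - ε, t)) (arcMeasure θ j)) ∧
      Integrable (fun r => F (r, θ j)) (segMeasure ε) ∧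
      Integrable (fun r => F (r, nextAngle θ j)) (segMeasure ε) := by
  rw [contourMeasure_eq, integrable_add_measure, integrable_add_measure, integrable_add_measure,
    (measurableEmbedding_arc _).integrable_map_iff, (measurableEmbedding_arc _).integrable_map_iff,
    (measurableEmbedding_seg _).integrable_map_iff, (measurableEmbedding_seg _).integrable_map_iff,
    and_assoc]
  rfl

lemma integral_contourMeasure {F : ℝ × ℝ → ℂ} (hF : Integrable F (contourMeasure θ ε j)) :
    ∫ q, F q ∂contourMeasure θ ε j =
      (∫ t, F (1 + ε, t) ∂arcMeasure θ j) + (∫ t, F (1 - ε, t) ∂arcMeasure θ j) +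
      (∫ r, F (r, θ j) ∂segMeasure ε) + ∫ r, F (r, nextAngle θ j) ∂segMeasure ε := by
  have h := hF
  rw [contourMeasure_eq, integrable_add_measure, integrable_add_measure,
    integrable_add_measure] at h
  rw [contourMeasure_eq, integral_add_measure
      (integrable_add_measure.2 ⟨integrable_add_measure.2 h.1.1, h.1.2⟩) h.2,
    integral_add_measure (integrable_add_measure.2 h.1.1) h.1.2,
    integral_add_measure h.1.1.1 h.1.1.2,
    (measurableEmbedding_arc _).integral_map, (measurableEmbedding_arc _).integral_map,
    (measurableEmbedding_seg _).integral_map, (measurableEmbedding_seg _).integral_map]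

lemma integral_arcMeasure (hθ : StrictMono θ) (hθr : ∀ j, θ j ∈ Ico 0 (2 * Real.pi))
    (F : ℝ → ℂ) : ∫ t, F t ∂arcMeasure θ j =
      (1 / (2 * Real.pi) : ℂ) * ∫ t in θ j..nextAngle θ j, F t := by
  rw [arcMeasure, integral_smul_measure, ENNReal.toReal_ofReal (by positivity),
    intervalIntegral.integral_of_le (lt_nextAngle hθ hθr j).le, integral_Ioc_eq_integral_Ioo,
    Complex.real_smul]
  push_cast
  rfl

lemma integral_segMeasure (hε : ε ∈ Ioo (0 : ℝ) 1) (F : ℝ → ℂ) :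
    ∫ r, F r ∂segMeasure ε =
      (1 / (2 * Real.pi) : ℂ) * ∫ r in Ioo (1 - ε) (1 + ε), (r⁻¹ : ℝ) • F r := by
  rw [segMeasure, integral_withDensity_eq_integral_toReal_smul (by fun_prop)
    (ae_of_all _ fun _ => ENNReal.ofReal_lt_top), ← integral_const_mul]
  refine setIntegral_congr_fun measurableSet_Ioo fun r hr => ?_
  have hr0 : 0 < r := by linarith [hr.1, hε.2]
  rw [ENNReal.toReal_ofReal (by positivity), Complex.real_smul, Complex.real_smul]
  push_cast
  rw [one_div, one_div, mul_inv]
  ring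

lemma ae_mem_closedInside (hθ : StrictMono θ) (hθr : ∀ j, θ j ∈ Ico 0 (2 * Real.pi))
    (hε : ε ∈ Ioo (0 : ℝ) 1) : ∀ᵐ q ∂contourMeasure θ ε j, q ∈ closedInside θ ε j := by
  have h0 := hε.1
  have hlt := (lt_nextAngle hθ hθr j).le
  exact ae_contourMeasure_iff.2 ⟨⟨ae_arcMeasure_of_forall fun t ht =>
      ⟨⟨by simp only; linarith, le_rfl⟩, Ioo_subset_Icc_self ht⟩,
    ae_arcMeasure_of_forall fun t ht =>
      ⟨⟨le_rfl, by simp only; linarith⟩, Ioo_subset_Icc_self ht⟩⟩,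
    ae_segMeasure_of_forall fun r hr _ => ⟨Ioo_subset_Icc_self hr, left_mem_Icc.2 hlt⟩,
    ae_segMeasure_of_forall fun r hr _ => ⟨Ioo_subset_Icc_self hr, right_mem_Icc.2 hlt⟩⟩

lemma ae_fst_ne_one (hε : ε ∈ Ioo (0 : ℝ) 1) : ∀ᵐ q ∂contourMeasure θ ε j, q.1 ≠ 1 := by
  have h0 := hε.1
  exact ae_contourMeasure_iff.2 ⟨⟨ae_arcMeasure_of_forall fun t ht => by simp; linarith,
    ae_arcMeasure_of_forall fun t ht => by simp; linarith⟩,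
    ae_segMeasure_of_forall fun r hr h => h, ae_segMeasure_of_forall fun r hr h => h⟩

lemma measurableSet_closedInside : MeasurableSet (closedInside θ ε j) :=
  measurableSet_Icc.prod measurableSet_Icc

lemma isCompact_closedInside : IsCompact (closedInside θ ε j) := isCompact_Icc.prod isCompact_Icc

lemma aestronglyMeasurable_of_continuousOn (hθ : StrictMono θ)
    (hθr : ∀ j, θ j ∈ Ico 0 (2 * Real.pi)) (hε : ε ∈ Ioo (0 : ℝ) 1) {E : Type*}
    [NormedAddCommGroup E] [SecondCountableTopology E]
    {F : ℝ × ℝ → E} (hF : ContinuousOn F (closedInside θ ε j)) :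
    AEStronglyMeasurable F (contourMeasure θ ε j) := by
  have := Measure.restrict_eq_self_of_ae_mem (ae_mem_closedInside (j := j) hθ hθr hε)
  rw [← this]
  borelize E
  exact hF.aestronglyMeasurable measurableSet_closedInside

lemma exists_ae_norm_le (hθ : StrictMono θ)
    (hθr : ∀ j, θ j ∈ Ico 0 (2 * Real.pi)) (hε : ε ∈ Ioo (0 : ℝ) 1) {E : Type*}
    [NormedAddCommGroup E]
    {F : ℝ × ℝ → E} (hF : ContinuousOn F (closedInside θ ε j)) :
    ∃ C, ∀ᵐ q ∂contourMeasure θ ε j, ‖F q‖ ≤ C := by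
  obtain ⟨C, hC⟩ := isCompact_closedInside.exists_bound_of_continuousOn hF
  exact ⟨C, (ae_mem_closedInside hθ hθr hε).mono hC⟩

lemma measurable_orientation : Measurable (orientation θ ε j) := by
  unfold orientation OnArc
  have h1 : MeasurableSet {q : ℝ × ℝ | q.1 = 1 - ε ∨ q.1 = 1 + ε} :=
    (measurableSet_eq_fun measurable_fst measurable_const).union
      (measurableSet_eq_fun measurable_fst measurable_const)
  have h2 : MeasurableSet {q : ℝ × ℝ | q.2 = θ j} :=
    measurableSet_eq_fun measurable_snd measurable_const
  have h3 : MeasurableSet {q : ℝ × ℝ | 1 < q.1} :=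
    measurableSet_lt measurable_const measurable_fst
  exact Measurable.ite h1 measurable_const (Measurable.ite h2
    (Measurable.ite h3 measurable_const measurable_const)
    (Measurable.ite h3 measurable_const measurable_const))

lemma measurable_arcFactor : Measurable (arcFactor ε) := by
  unfold arcFactor OnArc
  have h1 : MeasurableSet {q : ℝ × ℝ | q.1 = 1 - ε ∨ q.1 = 1 + ε} :=
    (measurableSet_eq_fun measurable_fst measurable_const).union
      (measurableSet_eq_fun measurable_fst measurable_const)
  exact Measurable.ite h1 measurable_const measurable_const

lemma norm_orientation (q : ℝ × ℝ) : ‖orientation θ ε j q‖ = 1 := by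
  unfold orientation
  split_ifs <;> simp

lemma norm_arcFactor (q : ℝ × ℝ) : ‖arcFactor ε q‖ = 1 := by
  unfold arcFactor
  split_ifs <;> simp

end Measures

end DiscreteToeplitz

/-! ### Deforming the arcs of the unit circle -/

namespace DiscreteToeplitz

open ComplexConjugate

section Sides

variable {k : ℕ} {p : ℕ} {a : ℕ → ℂ} {θ β : Fin k → ℝ} {ε : ℝ} {j : Fin k}

/-- Meant for one half of a segment, on one side of the circle: there `I` times the orientation sign
is a constant `c`, and on the other half the indicator kills the integrand. -/
lemma integral_segMeasure_of_eq (hε : ε ∈ Ioo (0 : ℝ) 1) {F G : ℝ → ℂ} {c : ℂ} {x y : ℝ}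
    (hxy : x ≤ y) (hsub : Ioo x y ⊆ Ioo (1 - ε) (1 + ε))
    (h₁ : ∀ r ∈ Ioo x y, F r = c * G r)
    (h₂ : ∀ r ∈ Ioo (1 - ε) (1 + ε), r ∉ Ioo x y → r ≠ 1 → F r = 0) :
    ∫ r, F r ∂segMeasure ε =
      (1 / (2 * Real.pi) : ℂ) * (c * ∫ r in x..y, (r⁻¹ : ℝ) • G r) := by
  rw [integral_segMeasure hε]
  congr 1
  have hae : ∀ᵐ r : ℝ, r ≠ 1 := by simp [ae_iff, measure_singleton]
  have hcongr : ∫ r in Ioo (1 - ε) (1 + ε), (r⁻¹ : ℝ) • F r =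
      ∫ r in Ioo (1 - ε) (1 + ε), (Ioo x y).indicator (fun r => c * ((r⁻¹ : ℝ) • G r)) r := by
    refine setIntegral_congr_ae measurableSet_Ioo ?_
    filter_upwards [hae] with r hr1 hr
    by_cases h : r ∈ Ioo x y
    · rw [indicator_of_mem h, h₁ r h, mul_smul_comm]
    · rw [indicator_of_notMem h, h₂ r hr h hr1, smul_zero]
  rw [hcongr, setIntegral_indicator measurableSet_Ioo, inter_eq_self_of_subset_right hsub,
    integral_const_mul, intervalIntegral.integral_of_le hxy, integral_Ioc_eq_integral_Ioo]

lemma arcFactor_of_mem {r : ℝ} (hr : r ∈ Ioo (1 - ε) (1 + ε)) (t : ℝ) :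
    arcFactor ε (r, t) = -Complex.I := by
  rw [arcFactor, if_neg]
  rintro (h | h)
  · exact hr.1.ne' h
  · exact hr.2.ne h

lemma orientation_left {r : ℝ} (hr : r ∈ Ioo (1 - ε) (1 + ε)) :
    orientation θ ε j (r, θ j) = if 1 < r then 1 else -1 := by
  rw [orientation, if_neg, if_pos rfl]
  rintro (h | h)
  · exact hr.1.ne' h
  · exact hr.2.ne h

lemma orientation_right (hθ : StrictMono θ) (hθr : ∀ j, θ j ∈ Ico 0 (2 * Real.pi)) {r : ℝ}
    (hr : r ∈ Ioo (1 - ε) (1 + ε)) :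
    orientation θ ε j (r, nextAngle θ j) = if 1 < r then -1 else 1 := by
  rw [orientation, if_neg, if_neg (lt_nextAngle hθ hθr j).ne']
  rintro (h | h)
  · exact hr.1.ne' h
  · exact hr.2.ne h

lemma arcFactor_arc {r : ℝ} (hr : r = 1 - ε ∨ r = 1 + ε) (t : ℝ) : arcFactor ε (r, t) = 1 := by
  rw [arcFactor, if_pos]
  exact hr

lemma orientation_arc {r : ℝ} (hr : r = 1 - ε ∨ r = 1 + ε) (t : ℝ) :
    orientation θ ε j (r, t) = 1 := by
  rw [orientation, if_pos]
  exact hr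

lemma continuousOn_comp_polar (hε : ε ∈ Ioo (0 : ℝ) 1) {h : ℂ → ℂ}
    (hh : ∀ z ≠ 0, DifferentiableAt ℂ h z) :
    ContinuousOn (fun q => h (polar q)) (closedInside θ ε j) := by
  intro q hq
  have hq1 : 0 < q.1 := by have := hq.1.1; linarith [hε.2]
  exact ((hh _ (polar_ne_zero hq1)).continuousAt.comp
    continuous_polar.continuousAt).continuousWithinAt

lemma continuousOn_comp_polar_mul_boundaryValue (hθ : StrictMono θ)
    (hθr : ∀ j, θ j ∈ Ico 0 (2 * Real.pi))
    (hβ : ∀ j, 0 < β j) (hε : ε ∈ Ioo (0 : ℝ) 1) {h : ℂ → ℂ}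
    (hh : ∀ z ≠ 0, DifferentiableAt ℂ h z) :
    ContinuousOn (fun q => h (polar q) * boundaryValue θ ε (symbolExt p a θ β) j q)
      (closedInside θ ε j) :=
  (continuousOn_comp_polar hε hh).mul (continuousOn_boundaryValue hθ hθr hβ hε j)

lemma integrable_indicator_side (hθ : StrictMono θ) (hθr : ∀ j, θ j ∈ Ico 0 (2 * Real.pi))
    (hε : ε ∈ Ioo (0 : ℝ) 1) {G : ℝ × ℝ → ℂ} (hG : ContinuousOn G (closedInside θ ε j))
    {S : Set (ℝ × ℝ)} (hS : MeasurableSet S) :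
    Integrable (fun q => arcFactor ε q * orientation θ ε j q * S.indicator G q)
      (contourMeasure θ ε j) := by
  have := isFiniteMeasure_contourMeasure (θ := θ) (j := j) hε
  obtain ⟨C, hC⟩ := exists_ae_norm_le hθ hθr hε hG
  refine Integrable.of_bound (C := C) ?_ ?_
  · exact (measurable_arcFactor.mul measurable_orientation).aestronglyMeasurable.mul
      ((aestronglyMeasurable_of_continuousOn hθ hθr hε hG).indicator hS)
  · filter_upwards [hC] with q hq
    rw [norm_mul, norm_mul, norm_arcFactor, norm_orientation, one_mul, one_mul]
    exact (norm_indicator_le_norm_self _ _).trans hq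

/-- Cauchy's theorem for the rectangle between radii `1` and `1 + ε` replaces the circular arc by
segment, outer arc, segment. On the segments `I = -i = 1/i` turns `σ = dz/(2πz)` into `dz/(2πiz)`.
-/
lemma integral_outer (hθ : StrictMono θ) (hθr : ∀ j, θ j ∈ Ico 0 (2 * Real.pi))
    (hβ : ∀ j, 0 < β j) (hε : ε ∈ Ioo (0 : ℝ) 1) {h : ℂ → ℂ}
    (hh : ∀ z ≠ 0, DifferentiableAt ℂ h z) :
    ∫ q, arcFactor ε q * orientation θ ε j q * {q : ℝ × ℝ | 1 < q.1}.indicator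
      (fun q => h (polar q) * boundaryValue θ ε (symbolExt p a θ β) j q) q
        ∂contourMeasure θ ε j =
    (1 / (2 * Real.pi) : ℂ) * ∫ t in θ j..nextAngle θ j,
      h (Complex.exp (t * Complex.I)) * symbol p a θ β (Complex.exp (t * Complex.I)) := by
  have hε0 := hε.1
  have hlt := lt_nextAngle hθ hθr j
  set G : ℝ × ℝ → ℂ := fun q => h (polar q) * boundaryValue θ ε (symbolExt p a θ β) j q with hGdef
  have hG : ContinuousOn G (closedInside θ ε j) :=
    continuousOn_comp_polar_mul_boundaryValue hθ hθr hβ hε hh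
  have hS : MeasurableSet {q : ℝ × ℝ | 1 < q.1} := measurableSet_lt measurable_const measurable_fst
  have hone : ∫ t in θ j..nextAngle θ j, G (1, t) = ∫ t in θ j..nextAngle θ j,
      h (Complex.exp (t * Complex.I)) * symbol p a θ β (Complex.exp (t * Complex.I)) := by
    refine intervalIntegral.integral_congr_Ioo_of_le hlt.le fun t ht => ?_
    simp only [hGdef]
    rw [boundaryValue_one hθ hθr hε ht]
    simp [polar]
  have hcauchy := integral_boundary_polar_rect (G := G)
    (g := fun z => h z * symbolExt p a θ β z) (r₁ := 1) (r₂ := 1 + ε) one_pos (by linarith) hlt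
    (hG.mono (prod_mono (Icc_subset_Icc_left (by linarith)) le_rfl)) ?_ ?_
  · rw [← hone, integral_contourMeasure (integrable_indicator_side hθ hθr hε hG hS),
      integral_arcMeasure hθ hθr, integral_arcMeasure hθ hθr,
      integral_segMeasure_of_eq (x := 1) (y := 1 + ε) (c := -Complex.I)
        (G := fun r => G (r, θ j)) hε (by linarith) (Ioo_subset_Ioo_left (by linarith)),
      integral_segMeasure_of_eq (x := 1) (y := 1 + ε) (c := Complex.I)
        (G := fun r => G (r, nextAngle θ j)) hε (by linarith) (Ioo_subset_Ioo_left (by linarith))]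
    · have e1 : ∀ t, arcFactor ε (1 + ε, t) * orientation θ ε j (1 + ε, t) *
          {q : ℝ × ℝ | 1 < q.1}.indicator G (1 + ε, t) = G (1 + ε, t) := by
        intro t
        rw [arcFactor_arc (Or.inr rfl), orientation_arc (Or.inr rfl),
          indicator_of_mem (by simpa using hε0)]
        ring
      have e2 : ∀ t, arcFactor ε (1 - ε, t) * orientation θ ε j (1 - ε, t) *
          {q : ℝ × ℝ | 1 < q.1}.indicator G (1 - ε, t) = 0 := by
        intro t
        rw [indicator_of_notMem (by simpa using hε0.le), mul_zero]
      simp_rw [e1, e2]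
      rw [intervalIntegral.integral_zero]
      have hI := Complex.I_mul_I
      -- Dividing Cauchy's identity by `2πi`; the second term replaces `I * I` by `-1` in the two
      -- arc integrals.
      linear_combination (-1 / (2 * Real.pi) : ℂ) * Complex.I * hcauchy +
        (1 / (2 * Real.pi) : ℂ) * ((∫ t in θ j..nextAngle θ j, G (1 + ε, t)) -
          (∫ t in θ j..nextAngle θ j, G (1, t))) * hI
    · intro r hr
      have hr' : r ∈ Ioo (1 - ε) (1 + ε) := ⟨by linarith [hr.1], hr.2⟩
      rw [arcFactor_of_mem hr', orientation_right hθ hθr hr', if_pos hr.1,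
        indicator_of_mem (by exact hr.1)]
      ring
    · intro r hr hn _
      rw [indicator_of_notMem (s := {q : ℝ × ℝ | 1 < q.1}) (fun h => hn ⟨h, hr.2⟩), mul_zero]
    · intro r hr
      have hr' : r ∈ Ioo (1 - ε) (1 + ε) := ⟨by linarith [hr.1], hr.2⟩
      rw [arcFactor_of_mem hr', orientation_left hr', if_pos hr.1,
        indicator_of_mem (by exact hr.1)]
      ring
    · intro r hr hn _
      rw [indicator_of_notMem (s := {q : ℝ × ℝ | 1 < q.1}) (fun h => hn ⟨h, hr.2⟩), mul_zero]
  · intro q hq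
    have hq' : q ∈ inside θ ε j := ⟨⟨by linarith [hq.1.1], hq.1.2⟩, hq.2⟩
    simp only [hGdef]
    rw [boundaryValue_eq_symbolExt hθ hθr hε hq']
  · intro q hq
    have hq' : q ∈ inside θ ε j := ⟨⟨by linarith [hq.1.1], hq.1.2⟩, hq.2⟩
    exact (hh _ (polar_ne_zero (fst_pos_of_mem_inside hε hq'))).mul
      (differentiableAt_symbolExt hθ hθr hε hq')

/-- The mirror image of `integral_outer`: the path starts at `w_j` inwards, so the signs on both
segments are reversed. -/
lemma integral_inner (hθ : StrictMono θ) (hθr : ∀ j, θ j ∈ Ico 0 (2 * Real.pi))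
    (hβ : ∀ j, 0 < β j) (hε : ε ∈ Ioo (0 : ℝ) 1) {h : ℂ → ℂ}
    (hh : ∀ z ≠ 0, DifferentiableAt ℂ h z) :
    ∫ q, arcFactor ε q * orientation θ ε j q * {q : ℝ × ℝ | q.1 < 1}.indicator
      (fun q => h (polar q) * boundaryValue θ ε (symbolExt p a θ β) j q) q
        ∂contourMeasure θ ε j =
    (1 / (2 * Real.pi) : ℂ) * ∫ t in θ j..nextAngle θ j,
      h (Complex.exp (t * Complex.I)) * symbol p a θ β (Complex.exp (t * Complex.I)) := by
  have hε0 := hε.1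
  have hlt := lt_nextAngle hθ hθr j
  set G : ℝ × ℝ → ℂ := fun q => h (polar q) * boundaryValue θ ε (symbolExt p a θ β) j q with hGdef
  have hG : ContinuousOn G (closedInside θ ε j) :=
    continuousOn_comp_polar_mul_boundaryValue hθ hθr hβ hε hh
  have hS : MeasurableSet {q : ℝ × ℝ | q.1 < 1} := measurableSet_lt measurable_fst measurable_const
  have hone : ∫ t in θ j..nextAngle θ j, G (1, t) = ∫ t in θ j..nextAngle θ j,
      h (Complex.exp (t * Complex.I)) * symbol p a θ β (Complex.exp (t * Complex.I)) := by
    refine intervalIntegral.integral_congr_Ioo_of_le hlt.le fun t ht => ?_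
    simp only [hGdef]
    rw [boundaryValue_one hθ hθr hε ht]
    simp [polar]
  have hcauchy := integral_boundary_polar_rect (G := G)
    (g := fun z => h z * symbolExt p a θ β z) (r₁ := 1 - ε) (r₂ := 1) (by linarith [hε.2])
    (by linarith) hlt
    (hG.mono (prod_mono (Icc_subset_Icc_right (by linarith)) le_rfl)) ?_ ?_
  · rw [← hone, integral_contourMeasure (integrable_indicator_side hθ hθr hε hG hS),
      integral_arcMeasure hθ hθr, integral_arcMeasure hθ hθr,
      integral_segMeasure_of_eq (x := 1 - ε) (y := 1) (c := Complex.I)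
        (G := fun r => G (r, θ j)) hε (by linarith) (Ioo_subset_Ioo_right (by linarith)),
      integral_segMeasure_of_eq (x := 1 - ε) (y := 1) (c := -Complex.I)
        (G := fun r => G (r, nextAngle θ j)) hε (by linarith) (Ioo_subset_Ioo_right (by linarith))]
    · have e1 : ∀ t, arcFactor ε (1 - ε, t) * orientation θ ε j (1 - ε, t) *
          {q : ℝ × ℝ | q.1 < 1}.indicator G (1 - ε, t) = G (1 - ε, t) := by
        intro t
        rw [arcFactor_arc (Or.inl rfl), orientation_arc (Or.inl rfl),
          indicator_of_mem (by simpa using hε0)]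
        ring
      have e2 : ∀ t, arcFactor ε (1 + ε, t) * orientation θ ε j (1 + ε, t) *
          {q : ℝ × ℝ | q.1 < 1}.indicator G (1 + ε, t) = 0 := by
        intro t
        rw [indicator_of_notMem (by simpa using hε0.le), mul_zero]
      simp_rw [e1, e2]
      rw [intervalIntegral.integral_zero]
      have hI := Complex.I_mul_I
      linear_combination (1 / (2 * Real.pi) : ℂ) * Complex.I * hcauchy +
        (1 / (2 * Real.pi) : ℂ) * ((∫ t in θ j..nextAngle θ j, G (1 - ε, t)) -
          (∫ t in θ j..nextAngle θ j, G (1, t))) * hI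
    · intro r hr
      have hr' : r ∈ Ioo (1 - ε) (1 + ε) := ⟨hr.1, by linarith [hr.2]⟩
      rw [arcFactor_of_mem hr', orientation_right hθ hθr hr', if_neg hr.2.not_gt,
        indicator_of_mem (by exact hr.2)]
      ring
    · intro r hr hn _
      rw [indicator_of_notMem (s := {q : ℝ × ℝ | q.1 < 1}) (fun h => hn ⟨hr.1, h⟩), mul_zero]
    · intro r hr
      have hr' : r ∈ Ioo (1 - ε) (1 + ε) := ⟨hr.1, by linarith [hr.2]⟩
      rw [arcFactor_of_mem hr', orientation_left hr', if_neg hr.2.not_gt,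
        indicator_of_mem (by exact hr.2)]
      ring
    · intro r hr hn _
      rw [indicator_of_notMem (s := {q : ℝ × ℝ | q.1 < 1}) (fun h => hn ⟨hr.1, h⟩), mul_zero]
  · intro q hq
    have hq' : q ∈ inside θ ε j := ⟨⟨hq.1.1, by linarith [hq.1.2]⟩, hq.2⟩
    simp only [hGdef]
    rw [boundaryValue_eq_symbolExt hθ hθr hε hq']
  · intro q hq
    have hq' : q ∈ inside θ ε j := ⟨⟨hq.1.1, by linarith [hq.1.2]⟩, hq.2⟩
    exact (hh _ (polar_ne_zero (fst_pos_of_mem_inside hε hq'))).mul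
      (differentiableAt_symbolExt hθ hθr hε hq')

lemma sum_integral_arcs (hk : 0 < k) {H : ℂ → ℂ}
    (hH : Continuous fun t : ℝ => H (Complex.exp (t * Complex.I))) :
    ∑ j, (1 / (2 * Real.pi) : ℂ) * ∫ t in θ j..nextAngle θ j, H (Complex.exp (t * Complex.I)) =
      circleMean H := by
  rw [← Finset.mul_sum, circleMean]
  congr 1
  -- The endpoints of the sectors, closed up at index `k`. They tile one period starting at the
  -- first angle, which periodicity moves to `[0, 2π]`.
  let s : ℕ → ℝ := fun i => if h : i < k then θ ⟨i, h⟩ else θ ⟨0, hk⟩ + 2 * Real.pi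
  have hs : ∀ j : Fin k, s j = θ j := fun j => by simp [s]
  have hs' : ∀ j : Fin k, s (j + 1) = nextAngle θ j := fun j => by simp [s, nextAngle]
  have := intervalIntegral.sum_integral_adjacent_intervals (μ := volume) (a := s) (n := k)
    (f := fun t : ℝ => H (Complex.exp (t * Complex.I)))
    fun i _ => hH.intervalIntegrable _ _
  rw [Finset.sum_range] at this
  simp_rw [hs, hs'] at this
  rw [this]
  have h0 : s 0 = θ ⟨0, hk⟩ := by simp [s, hk]
  have hk' : s k = θ ⟨0, hk⟩ + 2 * Real.pi := by simp [s]
  have hper : Function.Periodic (fun t : ℝ => H (Complex.exp (t * Complex.I))) (2 * Real.pi) := by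
    intro t
    simp only
    push_cast
    rw [add_mul, Complex.exp_add, Complex.exp_two_pi_mul_I, mul_one]
  rw [h0, hk', hper.intervalIntegral_add_eq _ 0, zero_add]

end Sides

end DiscreteToeplitz

/-! ### Domination at the singularities -/

namespace DiscreteToeplitz

open ComplexConjugate Polynomial

section Domination

variable {k : ℕ} {p : ℕ} {a : ℕ → ℂ} {θ β : Fin k → ℝ} {ε : ℝ} {j : Fin k}

lemma intervalIntegrable_abs_rpow {s : ℝ} (hs : -1 < s) (c : ℝ) :
    IntervalIntegrable (fun x : ℝ => |x| ^ s) volume 0 c := by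
  rcases le_total 0 c with hc | hc
  · refine (intervalIntegral.intervalIntegrable_rpow' hs).congr fun x hx => ?_
    rw [uIoc_of_le hc] at hx
    simp only [abs_of_pos hx.1]
  · have h := (intervalIntegral.intervalIntegrable_rpow' (a := 0) (b := -c) hs).comp_sub_left 0
    simp only [zero_sub, sub_zero, neg_neg] at h
    refine h.congr fun x hx => ?_
    rw [uIoc_of_ge hc] at hx
    simp only [abs_of_nonpos hx.2]

lemma integrable_abs_rpow_segMeasure (hε : ε ∈ Ioo (0 : ℝ) 1) {s : ℝ} (hs : -1 < s) :
    Integrable (fun r : ℝ => |1 - r| ^ s) (segMeasure ε) := by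
  have h1 : IntervalIntegrable (fun x : ℝ => |x| ^ s) volume ε (-ε) :=
    (intervalIntegrable_abs_rpow hs ε).symm.trans (intervalIntegrable_abs_rpow hs (-ε))
  have h2 := h1.comp_sub_left 1
  rw [sub_neg_eq_add, intervalIntegrable_iff_integrableOn_Ioo_of_le (by linarith [hε.1])] at h2
  have hle : segMeasure ε ≤ ENNReal.ofReal (1 / (2 * Real.pi * (1 - ε))) •
      volume.restrict (Ioo (1 - ε) (1 + ε)) := by
    rw [← withDensity_const, segMeasure]
    refine withDensity_mono ?_
    refine (ae_restrict_iff' measurableSet_Ioo).2 (ae_of_all _ fun r hr => ?_)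
    refine ENNReal.ofReal_le_ofReal ?_
    have : 0 < 1 - ε := by linarith [hε.2]
    have := hr.1.le
    gcongr
  exact (Integrable.smul_measure h2 ENNReal.ofReal_ne_top).mono_measure hle

lemma integrable_boundaryValue (hθ : StrictMono θ) (hθr : ∀ j, θ j ∈ Ico 0 (2 * Real.pi))
    (hβ : ∀ j, 0 < β j) (hε : ε ∈ Ioo (0 : ℝ) 1) :
    Integrable (boundaryValue θ ε (symbolExt p a θ β) j) (contourMeasure θ ε j) := by
  have := isFiniteMeasure_contourMeasure (θ := θ) (j := j) hε
  have hc := continuousOn_boundaryValue (p := p) (a := a) hθ hθr hβ hε j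
  obtain ⟨C, hC⟩ := exists_ae_norm_le hθ hθr hε hc
  exact Integrable.of_bound (aestronglyMeasurable_of_continuousOn hθ hθr hε hc) C hC

/-- The zero of order `β_l` of the symbol leaves `|1-r|^{β_l - 1}`, integrable exactly because `β_l
> 0`. -/
lemma integrable_seg_of_sing (hθ : StrictMono θ) (hθr : ∀ j, θ j ∈ Ico 0 (2 * Real.pi))
    (hβ : ∀ j, 0 < β j) (hε : ε ∈ Ioo (0 : ℝ) 1) {τ : ℝ}
    (hτ : τ ∈ Icc (θ j) (nextAngle θ j)) {l : Fin k}
    (hl : Complex.exp (τ * Complex.I) = sing θ l)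
    (hmeas : AEStronglyMeasurable (fun r => boundaryValue θ ε (symbolExt p a θ β) j (r, τ))
      (segMeasure ε)) :
    Integrable (fun r => |1 - r|⁻¹ * ‖boundaryValue θ ε (symbolExt p a θ β) j (r, τ)‖)
      (segMeasure ε) := by
  obtain ⟨C, hC0, hC⟩ := exists_norm_boundaryValue_le (p := p) (a := a) hθ hθr hβ hε j l
  have hdom := (integrable_abs_rpow_segMeasure hε
    (s := β l - 1) (by linarith [hβ l])).const_mul C
  refine hdom.mono ?_ ?_
  · exact (by fun_prop : Measurable fun r : ℝ => |1 - r|⁻¹).aestronglyMeasurable.mul hmeas.norm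
  · refine ae_segMeasure_of_forall fun r hr hr1 => ?_
    have hpos : 0 < |1 - r| := abs_pos.2 (sub_ne_zero.2 hr1.symm)
    have h1 := hC (r, τ) ⟨Ioo_subset_Icc_self hr, hτ⟩ hl
    rw [Real.rpow_sub_one hpos.ne', norm_mul, norm_mul, norm_norm, norm_inv, norm_div,
      Real.norm_eq_abs, Real.norm_eq_abs, Real.norm_eq_abs, abs_abs, abs_of_nonneg hC0,
      abs_of_nonneg (Real.rpow_nonneg (abs_nonneg _) _)]
    simp only at h1
    calc |1 - r|⁻¹ * ‖boundaryValue θ ε (symbolExt p a θ β) j (r, τ)‖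
        ≤ |1 - r|⁻¹ * (C * |1 - r| ^ β l) := by gcongr
      _ = C * (|1 - r| ^ β l / |1 - r|) := by ring

/-- `|1-r|⁻¹` bounds `|v|` for every `M ≥ 1`, so this one function dominates all the series below.
On the arcs `|1-r|` is the constant `ε`. -/
lemma integrable_inv_mul_norm_boundaryValue (hθ : StrictMono θ)
    (hθr : ∀ j, θ j ∈ Ico 0 (2 * Real.pi)) (hβ : ∀ j, 0 < β j) (hε : ε ∈ Ioo (0 : ℝ) 1) :
    Integrable (fun q => |1 - q.1|⁻¹ * ‖boundaryValue θ ε (symbolExt p a θ β) j q‖)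
      (contourMeasure θ ε j) := by
  have hb := integrable_contourMeasure_iff.1
    (integrable_boundaryValue (p := p) (a := a) (j := j) hθ hθr hβ hε)
  have hlt := (lt_nextAngle hθ hθr j).le
  refine integrable_contourMeasure_iff.2 ⟨⟨hb.1.1.norm.const_mul |1 - (1 + ε)|⁻¹,
      hb.1.2.norm.const_mul |1 - (1 - ε)|⁻¹⟩,
    integrable_seg_of_sing hθ hθr hβ hε (left_mem_Icc.2 hlt) rfl hb.2.1.1, ?_⟩
  obtain ⟨l, hl⟩ := exists_sing_eq_exp_nextAngle (θ := θ) j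
  exact integrable_seg_of_sing hθ hθr hβ hε (right_mem_Icc.2 hlt) hl hb.2.2.1

/-- Dominated convergence with the geometric series of the norms as majorant. The powers start at
`1` because `v` has the form `u / (1 - u)`. -/
lemma hasSum_integral_geometric {X : Type*} [MeasurableSpace X] {μ : Measure X} {u h : X → ℂ}
    (hu : AEStronglyMeasurable u μ) (hh : AEStronglyMeasurable h μ) (hu1 : ∀ᵐ x ∂μ, ‖u x‖ < 1)
    (hint : Integrable (fun x => ‖u x‖ / (1 - ‖u x‖) * ‖h x‖) μ) :
    HasSum (fun n : ℕ => ∫ x, u x ^ (n + 1) * h x ∂μ) (∫ x, u x / (1 - u x) * h x ∂μ) := by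
  have hgeo : ∀ᵐ x ∂μ, HasSum (fun n : ℕ => ‖u x‖ ^ (n + 1) * ‖h x‖)
      (‖u x‖ / (1 - ‖u x‖) * ‖h x‖) := by
    filter_upwards [hu1] with x hx
    have := ((hasSum_geometric_of_lt_one (norm_nonneg (u x)) hx).mul_left ‖u x‖).mul_right ‖h x‖
    simpa only [pow_succ', div_eq_mul_inv] using this
  refine hasSum_integral_of_dominated_convergence (fun n x => ‖u x‖ ^ (n + 1) * ‖h x‖)
    (fun n => (hu.pow _).mul hh) (fun n => ae_of_all _ fun x => by rw [norm_mul, norm_pow])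
    (hgeo.mono fun x hx => hx.summable)
    (hint.congr (hgeo.mono fun x hx => hx.tsum_eq.symm)) ?_
  filter_upwards [hu1] with x hx
  have := ((hasSum_geometric_of_norm_lt_one hx).mul_left (u x)).mul_right (h x)
  simpa only [pow_succ', div_eq_mul_inv] using this

end Domination

/-! ### Fourier series and Poisson summation -/

section Fourier

/-- Rotation by a primitive root `ζ` permutes the roots of unity and multiplies the sum by `ζ^n`, so
the sum vanishes unless `ζ^n = 1`. -/
lemma discreteMean_zpow {M : ℕ} (hM : 0 < M) (n : ℤ) :
    discreteMean M (fun z => z ^ n) = if (M : ℤ) ∣ n then 1 else 0 := by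
  have hprim := Complex.isPrimitiveRoot_exp M hM.ne'
  set ζ := Complex.exp (2 * Real.pi * Complex.I / M)
  have hM' : (M : ℂ) ≠ 0 := by exact_mod_cast hM.ne'
  unfold discreteMean
  split_ifs with h
  · have : ∀ z ∈ nthRootsFinset M (1 : ℂ), z ^ n = 1 := by
      intro z hz
      obtain ⟨m, rfl⟩ := h
      rw [zpow_mul, zpow_natCast, (mem_nthRootsFinset hM _).1 hz, one_zpow]
    rw [Finset.sum_congr rfl this, Finset.sum_const, hprim.card_nthRootsFinset]
    simp [hM']
  · have hζn : ζ ^ n ≠ 1 := fun h1 => h ((hprim.zpow_eq_one_iff_dvd n).1 h1)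
    have hζ0 : ζ ≠ 0 := Complex.exp_ne_zero _
    have hζM : ζ ^ M = 1 := hprim.pow_eq_one
    have hshift : ∑ z ∈ nthRootsFinset M (1 : ℂ), z ^ n =
        ∑ z ∈ nthRootsFinset M (1 : ℂ), (ζ * z) ^ n := by
      refine (Finset.sum_nbij' (fun z => ζ * z) (fun z => ζ⁻¹ * z) ?_ ?_ ?_ ?_ ?_).symm
      · intro z hz
        rw [mem_nthRootsFinset hM] at hz ⊢
        rw [mul_pow, hζM, hz, mul_one]
      · intro z hz
        rw [mem_nthRootsFinset hM] at hz ⊢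
        rw [mul_pow, inv_pow, hζM, hz, inv_one, mul_one]
      · intro z _
        rw [inv_mul_cancel_left₀ hζ0]
      · intro z _
        rw [mul_inv_cancel_left₀ hζ0]
      · intro z _
        rfl
    simp_rw [mul_zpow] at hshift
    rw [← Finset.mul_sum] at hshift
    have : (1 - ζ ^ n) * ∑ z ∈ nthRootsFinset M (1 : ℂ), z ^ n = 0 := by
      linear_combination hshift
    rw [(mul_eq_zero.1 this).resolve_left (sub_ne_zero.2 hζn.symm), mul_zero]

variable {F : ℂ → ℂ}

lemma hasSum_fourier_circle (hF : Continuous fun t : ℝ => F (Complex.exp (t * Complex.I)))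
    (hs : Summable fun n : ℤ => circleMean fun z => z ^ n * F z) {z : ℂ} (hz : ‖z‖ = 1) :
    HasSum (fun n : ℤ => (circleMean fun z => z ^ (-n) * F z) * z ^ n) (F z) := by
  have hT : Fact (0 < 2 * Real.pi) := ⟨Real.two_pi_pos⟩
  have hpi : (Real.pi : ℂ) ≠ 0 := by exact_mod_cast Real.pi_ne_zero
  have hper : Function.Periodic (fun t : ℝ => F (Complex.exp (t * Complex.I))) (2 * Real.pi) := by
    intro t
    simp only
    push_cast
    rw [add_mul, Complex.exp_add, Complex.exp_two_pi_mul_I, mul_one]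
  have hfour : ∀ (n : ℤ) (t : ℝ), fourier n (t : AddCircle (2 * Real.pi)) =
      Complex.exp (t * Complex.I) ^ n := by
    intro n t
    rw [fourier_coe_apply, ← Complex.exp_int_mul]
    congr 1
    push_cast
    field_simp
  let f : C(AddCircle (2 * Real.pi), ℂ) :=
    ⟨hper.lift, continuous_coinduced_dom.2 hF⟩
  have hf : ∀ t : ℝ, f t = F (Complex.exp (t * Complex.I)) := fun t => rfl
  have hcoeff : ∀ n : ℤ, fourierCoeff f n = circleMean fun z => z ^ (-n) * F z := by
    intro n
    rw [fourierCoeff_eq_intervalIntegral _ _ 0, zero_add, circleMean, Complex.real_smul]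
    simp_rw [hfour, hf, smul_eq_mul]
    push_cast
    rfl
  have hsum : Summable (fourierCoeff f) := by
    simp_rw [funext hcoeff]
    exact (Equiv.neg ℤ).summable_iff.2 hs
  obtain ⟨t, rfl⟩ := exists_exp_mul_I hz
  have := has_pointwise_sum_fourier_series_of_summable hsum (t : AddCircle (2 * Real.pi))
  simpa only [hfour, hf, hcoeff, smul_eq_mul] using this

/-- Poisson summation on the circle. -/
lemma hasSum_discreteMean (hF : Continuous fun t : ℝ => F (Complex.exp (t * Complex.I)))
    (hs : Summable fun n : ℤ => circleMean fun z => z ^ n * F z) {M : ℕ} (hM : 0 < M) :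
    HasSum (fun m : ℤ => circleMean fun z => z ^ ((M : ℤ) * m) * F z) (discreteMean M F) := by
  have h1 : HasSum (fun n : ℤ => (circleMean fun z => z ^ (-n) * F z) *
      discreteMean M (fun z => z ^ n)) (discreteMean M F) := by
    have := (hasSum_sum (s := nthRootsFinset M (1 : ℂ)) fun z hz =>
      hasSum_fourier_circle hF hs (norm_eq_one_of_mem_nthRootsFinset hM hz)).mul_left (1 / (M : ℂ))
    refine this.congr_fun fun n => ?_
    rw [discreteMean, ← Finset.mul_sum]
    ring
  simp_rw [discreteMean_zpow hM] at h1
  -- The surviving frequencies are the multiples of `M`. The sign occurs because the coefficient of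
  -- `z^n` is the mean of `z^{-n} F`.
  have hinj : Function.Injective fun m : ℤ => -((M : ℤ) * m) := by
    intro m n h
    have hM' : (M : ℤ) ≠ 0 := by exact_mod_cast hM.ne'
    exact mul_left_cancel₀ hM' (neg_injective h)
  refine ((hinj.hasSum_iff ?_).2 h1).congr_fun fun m => ?_
  · intro n hn
    rw [if_neg, mul_zero]
    rintro ⟨m, rfl⟩
    exact hn ⟨-m, by simp⟩
  · simp

end Fourier

end DiscreteToeplitz

/-! ### The difference of the two means as a contour integral -/

namespace DiscreteToeplitz

open ComplexConjugate

section Residue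

variable {k : ℕ} {p : ℕ} {a : ℕ → ℂ} {θ β : Fin k → ℝ} {ε : ℝ} {j : Fin k} {g : ℂ → ℂ}

lemma measurable_polar : Measurable polar := continuous_polar.measurable

/-- The ratio of the geometric series of `v` on `|z| > 1`, and `0` on `|z| ≤ 1`. -/
noncomputable def outerRatio (M : ℕ) : ℝ × ℝ → ℂ :=
  {q : ℝ × ℝ | 1 < q.1}.indicator fun q => polar q ^ (-(M : ℤ))

/-- The ratio of the geometric series of `v` on `|z| < 1`, and `0` on `|z| ≥ 1`. -/
noncomputable def innerRatio (M : ℕ) : ℝ × ℝ → ℂ :=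
  {q : ℝ × ℝ | q.1 < 1}.indicator fun q => polar q ^ M

lemma measurable_outerRatio (M : ℕ) : Measurable (outerRatio M) :=
  (measurable_polar.pow_const (-(M : ℤ))).indicator (measurableSet_lt measurable_const measurable_fst)

lemma measurable_innerRatio (M : ℕ) : Measurable (innerRatio M) :=
  (measurable_polar.pow_const M).indicator (measurableSet_lt measurable_fst measurable_const)

/-- The ratio has modulus `r^{-M} ≤ r⁻¹`, and `x / (1 - x)` is increasing, which gives `1 / (r -
1)`. -/
lemma norm_outerRatio {M : ℕ} (hM : 0 < M) {q : ℝ × ℝ} (hq : 0 < q.1) :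
    ‖outerRatio M q‖ < 1 ∧ ‖outerRatio M q‖ / (1 - ‖outerRatio M q‖) ≤ |1 - q.1|⁻¹ := by
  by_cases h : 1 < q.1
  · have hinv : q.1⁻¹ < 1 := inv_lt_one_of_one_lt₀ h
    have hle : ‖outerRatio M q‖ ≤ q.1⁻¹ := by
      rw [outerRatio, indicator_of_mem (by exact h), norm_zpow, norm_polar hq, zpow_neg,
        zpow_natCast, ← inv_pow]
      exact pow_le_of_le_one (inv_pos.2 hq).le hinv.le hM.ne'
    refine ⟨hle.trans_lt hinv, ?_⟩
    calc ‖outerRatio M q‖ / (1 - ‖outerRatio M q‖) ≤ q.1⁻¹ / (1 - q.1⁻¹) := by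
          have : 0 < 1 - q.1⁻¹ := by linarith
          gcongr
      _ = |1 - q.1|⁻¹ := by
          have h1 : q.1 - 1 ≠ 0 := by linarith
          have h2 : 1 - q.1⁻¹ = (q.1 - 1) * q.1⁻¹ := by field_simp
          rw [abs_of_neg (by linarith), neg_sub, h2]
          field_simp
  · rw [outerRatio, indicator_of_notMem (by exact h)]
    simp

lemma norm_innerRatio {M : ℕ} (hM : 0 < M) {q : ℝ × ℝ} (hq : 0 < q.1) :
    ‖innerRatio M q‖ < 1 ∧ ‖innerRatio M q‖ / (1 - ‖innerRatio M q‖) ≤ |1 - q.1|⁻¹ := by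
  by_cases h : q.1 < 1
  · have hle : ‖innerRatio M q‖ ≤ q.1 := by
      rw [innerRatio, indicator_of_mem (by exact h), norm_pow, norm_polar hq]
      exact pow_le_of_le_one hq.le h.le hM.ne'
    refine ⟨hle.trans_lt h, ?_⟩
    have h1 : 0 < 1 - q.1 := by linarith
    calc ‖innerRatio M q‖ / (1 - ‖innerRatio M q‖) ≤ 1 / (1 - q.1) := by
          gcongr
          exact hle.trans h.le
      _ = |1 - q.1|⁻¹ := by rw [abs_of_pos h1, one_div]
  · rw [innerRatio, indicator_of_notMem (by exact h)]
    simp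

/-- Off the circle exactly one of the two ratios is nonzero, and the other summand is `0 / (1 - 0) =
0`. -/
lemma discWeight_eq {M : ℕ} {q : ℝ × ℝ} (hq : 0 < q.1) (h1 : q.1 ≠ 1) :
    discWeight M (polar q) = outerRatio M q / (1 - outerRatio M q) +
      innerRatio M q / (1 - innerRatio M q) := by
  rw [discWeight, norm_polar hq]
  rcases h1.lt_or_gt with h | h
  · rw [if_pos h, outerRatio, innerRatio, indicator_of_notMem (by exact h.not_gt),
      indicator_of_mem (by exact h)]
    simp
  · rw [if_neg h.not_gt, outerRatio, innerRatio, indicator_of_mem (by exact h),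
      indicator_of_notMem (by exact h.not_gt)]
    simp

lemma ae_fst_pos (hθ : StrictMono θ) (hθr : ∀ j, θ j ∈ Ico 0 (2 * Real.pi))
    (hε : ε ∈ Ioo (0 : ℝ) 1) : ∀ᵐ q ∂contourMeasure θ ε j, 0 < q.1 := by
  filter_upwards [ae_mem_closedInside hθ hθr hε] with q hq
  have := hq.1.1
  linarith [hε.2]

/-- The part of the contour integrand that does not depend on `M`. -/
noncomputable def contourIntegrand (p : ℕ) (a : ℕ → ℂ) (θ β : Fin k → ℝ) (ε : ℝ) (g : ℂ → ℂ)
    (j : Fin k) (q : ℝ × ℝ) : ℂ :=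
  arcFactor ε q * orientation θ ε j q * (g (polar q) * boundaryValue θ ε (symbolExt p a θ β) j q)

lemma aestronglyMeasurable_contourIntegrand (hθ : StrictMono θ)
    (hθr : ∀ j, θ j ∈ Ico 0 (2 * Real.pi)) (hβ : ∀ j, 0 < β j) (hε : ε ∈ Ioo (0 : ℝ) 1)
    (hg : ∀ z ≠ 0, DifferentiableAt ℂ g z) :
    AEStronglyMeasurable (contourIntegrand p a θ β ε g j) (contourMeasure θ ε j) :=
  (measurable_arcFactor.mul measurable_orientation).aestronglyMeasurable.mul
    (aestronglyMeasurable_of_continuousOn hθ hθr hε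
      (continuousOn_comp_polar_mul_boundaryValue hθ hθr hβ hε hg))

lemma integrable_mul_contourIntegrand (hθ : StrictMono θ)
    (hθr : ∀ j, θ j ∈ Ico 0 (2 * Real.pi)) (hβ : ∀ j, 0 < β j) (hε : ε ∈ Ioo (0 : ℝ) 1)
    (hg : ∀ z ≠ 0, DifferentiableAt ℂ g z) {w : ℝ × ℝ → ℂ}
    (hw : AEStronglyMeasurable w (contourMeasure θ ε j))
    (hb : ∀ᵐ q ∂contourMeasure θ ε j, ‖w q‖ ≤ |1 - q.1|⁻¹) :
    Integrable (fun q => w q * contourIntegrand p a θ β ε g j q) (contourMeasure θ ε j) := by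
  obtain ⟨C, hC⟩ := exists_ae_norm_le hθ hθr hε (continuousOn_comp_polar (θ := θ) (j := j) hε hg)
  refine ((integrable_inv_mul_norm_boundaryValue (p := p) (a := a) (j := j)
    hθ hθr hβ hε).const_mul C).mono'
    (hw.mul (aestronglyMeasurable_contourIntegrand hθ hθr hβ hε hg)) ?_
  filter_upwards [hb, hC] with q h1 h2
  rw [contourIntegrand, norm_mul, norm_mul, norm_mul, norm_arcFactor, norm_orientation, one_mul,
    one_mul, norm_mul]
  have hn := norm_nonneg (boundaryValue θ ε (symbolExt p a θ β) j q)
  calc ‖w q‖ * (‖g (polar q)‖ * ‖boundaryValue θ ε (symbolExt p a θ β) j q‖)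
      ≤ |1 - q.1|⁻¹ * (C * ‖boundaryValue θ ε (symbolExt p a θ β) j q‖) := by gcongr
    _ = _ := by ring

lemma hasSum_integral_ratio (hθ : StrictMono θ)
    (hθr : ∀ j, θ j ∈ Ico 0 (2 * Real.pi)) (hβ : ∀ j, 0 < β j) (hε : ε ∈ Ioo (0 : ℝ) 1)
    (hg : ∀ z ≠ 0, DifferentiableAt ℂ g z) {u : ℝ × ℝ → ℂ} (hu : Measurable u)
    (hb : ∀ q : ℝ × ℝ, 0 < q.1 → ‖u q‖ < 1 ∧ ‖u q‖ / (1 - ‖u q‖) ≤ |1 - q.1|⁻¹) :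
    HasSum (fun n : ℕ => ∫ q, u q ^ (n + 1) * contourIntegrand p a θ β ε g j q
        ∂contourMeasure θ ε j)
      (∫ q, u q / (1 - u q) * contourIntegrand p a θ β ε g j q ∂contourMeasure θ ε j) := by
  have hpos := ae_fst_pos (j := j) hθ hθr hε
  refine hasSum_integral_geometric hu.aestronglyMeasurable
    (aestronglyMeasurable_contourIntegrand hθ hθr hβ hε hg)
    (hpos.mono fun q hq => (hb q hq).1) ?_
  have hmeas : Measurable fun q => ((‖u q‖ / (1 - ‖u q‖) : ℝ) : ℂ) := by fun_prop
  have hnn : ∀ᵐ q ∂contourMeasure θ ε j, 0 ≤ ‖u q‖ / (1 - ‖u q‖) := by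
    filter_upwards [hpos] with q hq
    exact div_nonneg (norm_nonneg _) (by linarith [(hb q hq).1])
  refine (integrable_mul_contourIntegrand (p := p) (a := a) (j := j) hθ hθr hβ hε hg
    hmeas.aestronglyMeasurable ?_).norm.congr ?_
  · filter_upwards [hpos, hnn] with q hq h0
    rw [Complex.norm_real, Real.norm_of_nonneg h0]
    exact (hb q hq).2
  · filter_upwards [hnn] with q h0
    rw [norm_mul, Complex.norm_real, Real.norm_of_nonneg h0]

lemma integrable_ratio (hθ : StrictMono θ)
    (hθr : ∀ j, θ j ∈ Ico 0 (2 * Real.pi)) (hβ : ∀ j, 0 < β j) (hε : ε ∈ Ioo (0 : ℝ) 1)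
    (hg : ∀ z ≠ 0, DifferentiableAt ℂ g z) {u : ℝ × ℝ → ℂ} (hu : Measurable u)
    (hb : ∀ q : ℝ × ℝ, 0 < q.1 → ‖u q‖ < 1 ∧ ‖u q‖ / (1 - ‖u q‖) ≤ |1 - q.1|⁻¹) :
    Integrable (fun q => u q / (1 - u q) * contourIntegrand p a θ β ε g j q)
      (contourMeasure θ ε j) := by
  refine integrable_mul_contourIntegrand hθ hθr hβ hε hg
    (by fun_prop : Measurable fun q => u q / (1 - u q)).aestronglyMeasurable ?_
  filter_upwards [ae_fst_pos (j := j) hθ hθr hε] with q hq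
  refine le_trans ?_ (hb q hq).2
  rw [norm_div]
  have h1 : 0 < 1 - ‖u q‖ := by linarith [(hb q hq).1]
  have h2 : 1 - ‖u q‖ ≤ ‖1 - u q‖ := by simpa using norm_sub_norm_le (1 : ℂ) (u q)
  gcongr

lemma integrable_discWeight_mul (hθ : StrictMono θ)
    (hθr : ∀ j, θ j ∈ Ico 0 (2 * Real.pi)) (hβ : ∀ j, 0 < β j) (hε : ε ∈ Ioo (0 : ℝ) 1)
    (hg : ∀ z ≠ 0, DifferentiableAt ℂ g z) {M : ℕ} (hM : 0 < M) :
    Integrable (fun q => discWeight M (polar q) * contourIntegrand p a θ β ε g j q)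
      (contourMeasure θ ε j) := by
  refine ((integrable_ratio (p := p) (a := a) (j := j) hθ hθr hβ hε hg (measurable_outerRatio M)
    fun q => norm_outerRatio hM).add (integrable_ratio (p := p) (a := a) (j := j) hθ hθr hβ hε hg
    (measurable_innerRatio M) fun q => norm_innerRatio hM)).congr ?_
  filter_upwards [ae_fst_pos (j := j) hθ hθr hε, ae_fst_ne_one hε] with q hq h1
  rw [discWeight_eq hq h1]
  simp only [Pi.add_apply]
  ring

lemma continuous_mul_symbol (hβ : ∀ j, 0 < β j) (hg : ∀ z ≠ 0, DifferentiableAt ℂ g z) :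
    Continuous fun t : ℝ => g (Complex.exp (t * Complex.I)) *
      symbol p a θ β (Complex.exp (t * Complex.I)) :=
  (continuous_iff_continuousAt.2 fun t => (hg _ (exp_mul_I_ne_zero t)).continuousAt.comp_of_eq
    continuous_exp_mul_I.continuousAt rfl).mul (continuous_symbol_exp hβ)

lemma differentiableAt_zpow_mul (hg : ∀ z ≠ 0, DifferentiableAt ℂ g z) (m : ℤ) :
    ∀ z ≠ 0, DifferentiableAt ℂ (fun z => z ^ m * g z) z :=
  fun z hz => (differentiableAt_zpow.2 (Or.inl hz)).mul (hg z hz)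

/-- Each power of the ratio is a monomial in `z` on its side of the circle. So `integral_outer`
applies to it, although `v` itself has poles on the circle. -/
lemma sum_integral_outerRatio (hk : 0 < k) (hθ : StrictMono θ)
    (hθr : ∀ j, θ j ∈ Ico 0 (2 * Real.pi)) (hβ : ∀ j, 0 < β j) (hε : ε ∈ Ioo (0 : ℝ) 1)
    (hg : ∀ z ≠ 0, DifferentiableAt ℂ g z) (M n : ℕ) :
    ∑ j, ∫ q, outerRatio M q ^ (n + 1) * contourIntegrand p a θ β ε g j q ∂contourMeasure θ ε j =
      circleMean fun z => z ^ ((M : ℤ) * (-((n : ℤ) + 1))) * (g z * symbol p a θ β z) := by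
  have hh := differentiableAt_zpow_mul hg ((M : ℤ) * (-((n : ℤ) + 1)))
  have hsum := sum_integral_arcs (θ := θ) (H := fun z => z ^ ((M : ℤ) * (-((n : ℤ) + 1))) * g z *
    symbol p a θ β z) hk (continuous_mul_symbol (p := p) (a := a) (θ := θ)
    hβ hh)
  simp_rw [← integral_outer (p := p) (a := a) hθ hθr hβ hε hh] at hsum
  simp_rw [← mul_assoc]
  rw [← hsum]
  refine Finset.sum_congr rfl fun j _ => integral_congr_ae (ae_of_all _ fun q => ?_)
  by_cases h : 1 < q.1
  · simp only [outerRatio, contourIntegrand]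
    rw [indicator_of_mem (by exact h), indicator_of_mem (by exact h), ← zpow_natCast, ← zpow_mul]
    push_cast
    rw [show -(M : ℤ) * ((n : ℤ) + 1) = (M : ℤ) * (-((n : ℤ) + 1)) by ring]
    ring
  · simp only [outerRatio]
    rw [indicator_of_notMem (by exact h), indicator_of_notMem (by exact h)]
    simp

lemma sum_integral_innerRatio (hk : 0 < k) (hθ : StrictMono θ)
    (hθr : ∀ j, θ j ∈ Ico 0 (2 * Real.pi)) (hβ : ∀ j, 0 < β j) (hε : ε ∈ Ioo (0 : ℝ) 1)
    (hg : ∀ z ≠ 0, DifferentiableAt ℂ g z) (M n : ℕ) :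
    ∑ j, ∫ q, innerRatio M q ^ (n + 1) * contourIntegrand p a θ β ε g j q ∂contourMeasure θ ε j =
      circleMean fun z => z ^ ((M : ℤ) * ((n + 1 : ℕ) : ℤ)) * (g z * symbol p a θ β z) := by
  have hh := differentiableAt_zpow_mul hg ((M : ℤ) * ((n + 1 : ℕ) : ℤ))
  have hsum := sum_integral_arcs (θ := θ) (H := fun z => z ^ ((M : ℤ) * ((n + 1 : ℕ) : ℤ)) * g z *
    symbol p a θ β z) hk (continuous_mul_symbol (p := p) (a := a) (θ := θ)
    hβ hh)
  simp_rw [← integral_inner (p := p) (a := a) hθ hθr hβ hε hh] at hsum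
  simp_rw [← mul_assoc]
  rw [← hsum]
  refine Finset.sum_congr rfl fun j _ => integral_congr_ae (ae_of_all _ fun q => ?_)
  by_cases h : q.1 < 1
  · simp only [innerRatio, contourIntegrand]
    rw [indicator_of_mem (by exact h), indicator_of_mem (by exact h), ← pow_mul, ← zpow_natCast,
      Nat.cast_mul]
    ring
  · simp only [innerRatio]
    rw [indicator_of_notMem (by exact h), indicator_of_notMem (by exact h)]
    simp

/-- The difference of the discrete and the continuous mean as a contour integral. -/
theorem sum_integral_discWeight (hk : 0 < k) (hθ : StrictMono θ)
    (hθr : ∀ j, θ j ∈ Ico 0 (2 * Real.pi)) (hβ : ∀ j, 0 < β j) (hε : ε ∈ Ioo (0 : ℝ) 1)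
    (hg : ∀ z ≠ 0, DifferentiableAt ℂ g z) {M : ℕ} (hM : 0 < M) :
    ∑ j, ∫ q, discWeight M (polar q) * contourIntegrand p a θ β ε g j q ∂contourMeasure θ ε j =
      discreteMean M (fun z => g z * symbol p a θ β z) -
        circleMean (fun z => g z * symbol p a θ β z) := by
  have houter : ∀ {M : ℕ}, 0 < M → HasSum
      (fun n : ℕ => circleMean fun z => z ^ ((M : ℤ) * (-((n : ℤ) + 1))) * (g z * symbol p a θ β z))
      (∑ j, ∫ q, outerRatio M q / (1 - outerRatio M q) * contourIntegrand p a θ β ε g j q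
        ∂contourMeasure θ ε j) := by
    intro M hM
    simp_rw [← sum_integral_outerRatio hk hθ hθr hβ hε hg M]
    exact hasSum_sum fun j _ => hasSum_integral_ratio hθ hθr hβ hε hg (measurable_outerRatio M)
      fun q => norm_outerRatio hM
  -- The term `n = 0`, the continuous mean, is absent from the contour integrals and is added by
  -- hand.
  have hinner : ∀ {M : ℕ}, 0 < M → HasSum
      (fun n : ℕ => circleMean fun z => z ^ ((M : ℤ) * (n : ℤ)) * (g z * symbol p a θ β z))
      ((∑ j, ∫ q, innerRatio M q / (1 - innerRatio M q) * contourIntegrand p a θ β ε g j q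
        ∂contourMeasure θ ε j) + circleMean fun z => g z * symbol p a θ β z) := by
    intro M hM
    have h := hasSum_sum (s := Finset.univ) fun j _ =>
      hasSum_integral_ratio (p := p) (a := a) (j := j) hθ hθr hβ hε hg (measurable_innerRatio M)
      fun q => norm_innerRatio hM
    simp_rw [sum_integral_innerRatio hk hθ hθr hβ hε hg M] at h
    have h' := (hasSum_nat_add_iff (f := fun n : ℕ => circleMean fun z =>
      z ^ ((M : ℤ) * (n : ℤ)) * (g z * symbol p a θ β z)) 1).1 h
    simpa using h'
  -- The Fourier coefficients are summable by the case `M = 1` of the two contour series, so no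
  -- separate regularity estimate for the symbol is needed.
  have hsummable : Summable fun n : ℤ =>
      circleMean fun z => z ^ n * (g z * symbol p a θ β z) := by
    refine Summable.of_nat_of_neg_add_one ?_ ?_
    · simpa using (hinner one_pos).summable
    · simpa using (houter one_pos).summable
  have h1 := hasSum_discreteMean (continuous_mul_symbol (p := p) (a := a) (θ := θ) hβ hg)
    hsummable hM
  have h2 := HasSum.of_nat_of_neg_add_one
    (f := fun m : ℤ => circleMean fun z => z ^ ((M : ℤ) * m) * (g z * symbol p a θ β z))
    (hinner hM) (houter hM)
  rw [h1.unique h2, add_right_comm, add_sub_cancel_right, ← Finset.sum_add_distrib]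
  refine Finset.sum_congr rfl fun j _ => ?_
  rw [← integral_add (integrable_ratio hθ hθr hβ hε hg (measurable_innerRatio M)
    fun q => norm_innerRatio hM) (integrable_ratio hθ hθr hβ hε hg (measurable_outerRatio M)
    fun q => norm_outerRatio hM)]
  refine integral_congr_ae ?_
  filter_upwards [ae_fst_pos (j := j) hθ hθr hε, ae_fst_ne_one hε] with q hq h1
  rw [discWeight_eq hq h1]
  ring

end Residue

end DiscreteToeplitz

/-! ### Determinants of finite-rank operators -/

namespace DiscreteToeplitz

section FiniteRank

variable {H : Type*} [NormedAddCommGroup H] [InnerProductSpace ℂ H]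

/-- The operator `∑_m ⟨x_m, ·⟩ y_m`. -/
noncomputable def finiteRankOp {N : ℕ} (x y : Fin N → H) : H →L[ℂ] H :=
  ∑ m, (innerSL ℂ (x m)).smulRight (y m)

variable {N : ℕ} (x y : Fin N → H)

lemma finiteRankOp_apply (h : H) : finiteRankOp x y h = ∑ m, inner ℂ (x m) h • y m := by
  simp [finiteRankOp]

lemma finiteDimensional_range_finiteRankOp :
    FiniteDimensional ℂ (LinearMap.range (finiteRankOp x y : H →ₗ[ℂ] H)) := by
  have hle : LinearMap.range (finiteRankOp x y : H →ₗ[ℂ] H) ≤ Submodule.span ℂ (Set.range y) := by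
    rintro _ ⟨h, rfl⟩
    rw [ContinuousLinearMap.coe_coe, finiteRankOp_apply]
    exact Submodule.sum_mem _ fun m _ =>
      Submodule.smul_mem _ _ (Submodule.subset_span (Set.mem_range_self m))
  have := FiniteDimensional.span_of_finite ℂ (Set.finite_range y)
  exact Submodule.finiteDimensional_of_le hle

lemma isTraceClass_finiteRankOp : IsTraceClass (finiteRankOp x y) := by
  let x' : ℕ → H := fun n => if h : n < N then x ⟨n, h⟩ else 0
  let y' : ℕ → H := fun n => if h : n < N then y ⟨n, h⟩ else 0
  have hx' : ∀ n ∉ Finset.range N, x' n = 0 := fun n hn => by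
    simp only [x', Finset.mem_range] at hn ⊢
    rw [dif_neg hn]
  refine ⟨x', y', summable_of_ne_finset_zero (s := Finset.range N) fun n hn => ?_, fun h => ?_⟩
  · rw [hx' n hn, norm_zero, zero_mul]
  · have hs : finiteRankOp x y h = ∑ n ∈ Finset.range N, inner ℂ (x' n) h • y' n := by
      rw [finiteRankOp_apply, Finset.sum_range]
      simp [x', y']
    rw [hs]
    exact hasSum_sum_of_ne_finset_zero fun n hn => by rw [hx' n hn, inner_zero_left, zero_smul]

lemma det_id_add_comp {V : Type*} [AddCommGroup V] [Module ℂ V]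
    [FiniteDimensional ℂ V] (A : (Fin N → ℂ) →ₗ[ℂ] V) (B : V →ₗ[ℂ] Fin N → ℂ) :
    LinearMap.det (LinearMap.id + A ∘ₗ B) = LinearMap.det (LinearMap.id + B ∘ₗ A) := by
  classical
  let b := Module.finBasis ℂ V
  let c := Pi.basisFun ℂ (Fin N)
  rw [← LinearMap.det_toMatrix b, ← LinearMap.det_toMatrix c, map_add, map_add,
    LinearMap.toMatrix_comp b c b, LinearMap.toMatrix_comp c b c, LinearMap.toMatrix_id,
    LinearMap.toMatrix_id, Matrix.det_one_add_mul_comm]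

/-- As `F` contains the range, the projection does nothing and the compression is `A ∘ B` through
`ℂ^N`, with `B v = (⟨x_m, v⟩)` and `A c = ∑ c_m y_m`. Exchanging the factors leaves `B ∘ A`, whose
matrix is `(⟨x_m, y_n⟩)`. -/
lemma compressedDet_finiteRankOp {F : FinDimSubspace H} (hF : ∀ m, y m ∈ F.1) :
    compressedDet (finiteRankOp x y) F =
      Matrix.det (1 + Matrix.of fun m n => inner ℂ (x m) (y n)) := by
  have hfin : FiniteDimensional ℂ F.1 := F.2
  let A : (Fin N → ℂ) →ₗ[ℂ] F.1 := Fintype.linearCombination ℂ fun m => (⟨y m, hF m⟩ : F.1)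
  let B : F.1 →ₗ[ℂ] Fin N → ℂ :=
    LinearMap.pi fun m => (innerSL ℂ (x m) : H →ₗ[ℂ] ℂ) ∘ₗ F.1.subtype
  have hcomp : ((F.1.orthogonalProjectionOnto ∘L finiteRankOp x y ∘L F.1.subtypeL :
      F.1 →L[ℂ] F.1) : F.1 →ₗ[ℂ] F.1) = A ∘ₗ B := by
    ext v
    have hv : finiteRankOp x y v = ((A (B v) : F.1) : H) := by
      rw [finiteRankOp_apply, Fintype.linearCombination_apply, Submodule.coe_sum]
      rfl
    change ((F.1.orthogonalProjectionOnto (finiteRankOp x y v) : F.1) : H) = _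
    rw [hv, Submodule.orthogonalProjectionOnto_mem_subspace_eq_self]
    rfl
  rw [compressedDet, hcomp, det_id_add_comp, ← LinearMap.det_toMatrix',
    map_add, LinearMap.toMatrix'_id]
  congr 2
  ext m n
  rw [LinearMap.toMatrix'_apply]
  simp [A, B, Fintype.linearCombination_apply, Pi.single_apply]

lemma isDirectedOrder_finDimSubspace : IsDirectedOrder (FinDimSubspace H) := by
  refine ⟨fun F G => ?_⟩
  have hF : FiniteDimensional ℂ F.1 := F.2
  have hG : FiniteDimensional ℂ G.1 := G.2
  exact ⟨⟨F.1 ⊔ G.1, inferInstance⟩, le_sup_left (a := F.1), le_sup_right (a := F.1)⟩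

lemma hasFredholmDet_finiteRankOp : HasFredholmDet (finiteRankOp x y)
    (Matrix.det (1 + Matrix.of fun m n => inner ℂ (x m) (y n))) := by
  have hfin := FiniteDimensional.span_of_finite ℂ (Set.finite_range y)
  refine tendsto_const_nhds.congr' ?_
  filter_upwards [eventually_ge_atTop
    (⟨Submodule.span ℂ (Set.range y), hfin⟩ : FinDimSubspace H)] with F hF
  exact (compressedDet_finiteRankOp x y fun m =>
    hF (Submodule.subset_span (Set.mem_range_self m))).symm

lemma fredholmDet_finiteRankOp : fredholmDet (finiteRankOp x y) =
    Matrix.det (1 + Matrix.of fun m n => inner ℂ (x m) (y n)) := by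
  -- Directedness and nonemptiness make `atTop` a proper filter, so that the limit is unique.
  have := isDirectedOrder_finDimSubspace (H := H)
  have : Nonempty (FinDimSubspace H) := ⟨⟨⊥, inferInstance⟩⟩
  exact (hasFredholmDet_finiteRankOp x y).limUnder_eq

end FiniteRank

end DiscreteToeplitz

/-! ### The operator with kernel K -/

namespace DiscreteToeplitz

open ComplexConjugate Polynomial

section Operator

variable {k : ℕ} {p : ℕ} {a : ℕ → ℂ} {θ β : Fin k → ℝ} {ε : ℝ} {M : ℕ} {j : Fin k}

lemma measurable_discWeight (M : ℕ) : Measurable (discWeight M) := by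
  unfold discWeight
  refine Measurable.ite (measurableSet_lt measurable_norm measurable_const) ?_ ?_
  · fun_prop
  · have : Measurable fun z : ℂ => z ^ (-(M : ℤ)) := measurable_id.pow_const _
    exact this.div (measurable_const.sub this)

/-- The determinant involves the square root only through its square, so its branch is immaterial
there. -/
lemma sqrtWeight_mul_self (f : ℂ → ℂ) (q : ℝ × ℝ) :
    sqrtWeight θ ε M f j q * sqrtWeight θ ε M f j q =
      discWeight M (polar q) * boundaryValue θ ε f j q := by
  rw [sqrtWeight, ← sq, one_div]
  exact Complex.cpow_nat_inv_pow _ two_ne_zero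

lemma memLp_sqrtWeight (hθ : StrictMono θ)
    (hθr : ∀ j, θ j ∈ Ico 0 (2 * Real.pi)) (hβ : ∀ j, 0 < β j) (hε : ε ∈ Ioo (0 : ℝ) 1)
    (hM : 0 < M) :
    MemLp (sqrtWeight θ ε M (symbolExt p a θ β) j) 2 (contourMeasure θ ε j) := by
  have hmeas : AEStronglyMeasurable (sqrtWeight θ ε M (symbolExt p a θ β) j)
      (contourMeasure θ ε j) :=
    ((((measurable_discWeight M).comp measurable_polar).aemeasurable.mul
      (aestronglyMeasurable_of_continuousOn hθ hθr hε
        (continuousOn_boundaryValue hθ hθr hβ hε j)).aemeasurable).pow_const _).aestronglyMeasurable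
  rw [memLp_two_iff_integrable_sq_norm hmeas]
  -- The squared modulus of the root is `|v f|`, whose integrability is the case `g = 1` of the
  -- contour estimate.
  refine (integrable_discWeight_mul (p := p) (a := a) (j := j) (g := fun _ => 1) hθ hθr hβ hε
    (fun _ _ => differentiableAt_const _) hM).norm.congr (ae_of_all _ fun q => ?_)
  simp only
  rw [sq, ← norm_mul, sqrtWeight_mul_self, contourIntegrand, norm_mul, norm_mul, norm_mul,
    norm_mul, norm_mul, norm_arcFactor, norm_orientation]
  simp

lemma memLp_sqrtWeight_mul (hθ : StrictMono θ)
    (hθr : ∀ j, θ j ∈ Ico 0 (2 * Real.pi)) (hβ : ∀ j, 0 < β j) (hε : ε ∈ Ioo (0 : ℝ) 1)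
    (hM : 0 < M) {G : ℝ × ℝ → ℂ} (hG : ContinuousOn G (closedInside θ ε j)) :
    MemLp (fun q => sqrtWeight θ ε M (symbolExt p a θ β) j q * G q) 2 (contourMeasure θ ε j) := by
  have hs := memLp_sqrtWeight (p := p) (a := a) (j := j) hθ hθr hβ hε hM
  obtain ⟨C, hC⟩ := exists_ae_norm_le hθ hθr hε hG
  refine hs.of_le_mul (c := C)
    (hs.1.mul (aestronglyMeasurable_of_continuousOn hθ hθr hε hG)) ?_
  filter_upwards [hC] with q hq
  rw [norm_mul, mul_comm]
  gcongr

lemma countable_setOf_exp_eq (c : ℂ) : {t : ℝ | Complex.exp (t * Complex.I) = c}.Countable := by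
  rcases eq_empty_or_nonempty {t : ℝ | Complex.exp (t * Complex.I) = c} with h | ⟨s, hs⟩
  · rw [h]; exact countable_empty
  · refine (countable_range fun n : ℤ => s + n * (2 * Real.pi)).mono fun t ht => ?_
    have h : Complex.exp (t * Complex.I) = Complex.exp (s * Complex.I) :=
      (show _ = c from ht).trans (show _ = c from hs).symm
    obtain ⟨n, hn⟩ := Complex.exp_eq_exp_iff_exists_int.1 h
    refine ⟨n, ?_⟩
    have h1 : (t : ℂ) = s + n * (2 * Real.pi) := by
      have : ((t : ℂ) - (s + n * (2 * Real.pi))) * Complex.I = 0 := by linear_combination hn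
      exact sub_eq_zero.1 ((mul_eq_zero.1 this).resolve_right Complex.I_ne_zero)
    exact_mod_cast h1.symm

/-- The quotient defining `cdKernel` is degenerate when `z` and `w` are the same complex number,
which also happens for different points on the two edges of a cut. Given `w`, an arc has countably
many such angles and a segment at most one such radius. -/
lemma ae_polar_ne (hε : ε ∈ Ioo (0 : ℝ) 1) (c : ℂ) :
    ∀ᵐ q ∂contourMeasure θ ε j, polar q ≠ c := by
  have harc : ∀ r : ℝ, 0 < r → ∀ᵐ t ∂arcMeasure θ j, polar (r, t) ≠ c := by
    intro r hr
    refine (arcMeasure_absolutelyContinuous.trans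
      Measure.restrict_le_self.absolutelyContinuous).ae_le ?_
    have hr' : (r : ℂ) ≠ 0 := by exact_mod_cast hr.ne'
    refine ((countable_setOf_exp_eq (c / r)).mono fun t ht => ?_).measure_zero volume
    simp only [ne_eq, not_not, mem_ofPred_eq, polar, mem_compl_iff] at ht ⊢
    rw [eq_div_iff hr', ← ht, mul_comm]
  have hseg : ∀ τ : ℝ, ∀ᵐ r ∂segMeasure ε, polar (r, τ) ≠ c := by
    intro τ
    have hne : ∀ᵐ r ∂segMeasure ε, r ≠ ‖c‖ := by
      refine (segMeasure_absolutelyContinuous.trans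
        Measure.restrict_le_self.absolutelyContinuous).ae_le ?_
      have : ∀ᵐ r : ℝ, r ≠ ‖c‖ := by simp [ae_iff, measure_singleton]
      exact this
    have hpos : ∀ᵐ r ∂segMeasure ε, 0 < r :=
      ae_segMeasure_of_forall fun r hr _ => by linarith [hr.1, hε.2]
    filter_upwards [hne, hpos] with r h1 h2 h3
    exact h1 (by rw [← h3, norm_polar h2])
  exact ae_contourMeasure_iff.2 ⟨⟨harc _ (by linarith [hε.1]), harc _ (by linarith [hε.2])⟩,
    hseg _, hseg _⟩

/-- The factor of the kernel that depends on `z`, with the sign of `σ`. -/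
noncomputable def leftFactor (p : ℕ) (a : ℕ → ℂ) (θ β : Fin k → ℝ) (ε : ℝ) (M : ℕ) (P : ℂ[X])
    (j : Fin k) (q : ℝ × ℝ) : ℂ :=
  arcFactor ε q * orientation θ ε j q *
    (sqrtWeight θ ε M (symbolExt p a θ β) j q * (conjPoly P).eval (polar q)⁻¹)

/-- The factor of the kernel that depends on `w`. -/
noncomputable def rightFactor (p : ℕ) (a : ℕ → ℂ) (θ β : Fin k → ℝ) (ε : ℝ) (M : ℕ) (P : ℂ[X])
    (j : Fin k) (q : ℝ × ℝ) : ℂ :=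
  sqrtWeight θ ε M (symbolExt p a θ β) j q * P.eval (polar q)

lemma memLp_rightFactor (hθ : StrictMono θ)
    (hθr : ∀ j, θ j ∈ Ico 0 (2 * Real.pi)) (hβ : ∀ j, 0 < β j) (hε : ε ∈ Ioo (0 : ℝ) 1)
    (hM : 0 < M) (P : ℂ[X]) (j : Fin k) :
    MemLp (rightFactor p a θ β ε M P j) 2 (contourMeasure θ ε j) :=
  memLp_sqrtWeight_mul hθ hθr hβ hε hM (P.continuous.comp continuous_polar).continuousOn

lemma differentiableAt_conjPoly_inv (P : ℂ[X]) :
    ∀ z ≠ 0, DifferentiableAt ℂ (fun z => (conjPoly P).eval z⁻¹) z :=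
  fun _ hz => (conjPoly P).differentiable.differentiableAt.comp _ (differentiableAt_inv hz)

lemma memLp_leftFactor (hθ : StrictMono θ)
    (hθr : ∀ j, θ j ∈ Ico 0 (2 * Real.pi)) (hβ : ∀ j, 0 < β j) (hε : ε ∈ Ioo (0 : ℝ) 1)
    (hM : 0 < M) (P : ℂ[X]) (j : Fin k) :
    MemLp (leftFactor p a θ β ε M P j) 2 (contourMeasure θ ε j) := by
  have h := memLp_sqrtWeight_mul (p := p) (a := a) (j := j) hθ hθr hβ hε hM
    (continuousOn_comp_polar hε (differentiableAt_conjPoly_inv P))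
  refine h.of_le
    ((measurable_arcFactor.mul measurable_orientation).aestronglyMeasurable.mul h.1)
    (ae_of_all _ fun q => ?_)
  rw [leftFactor, norm_mul, norm_mul, norm_arcFactor, norm_orientation, one_mul, one_mul]

/-- The conjugate is the vector `x_m` to use, since `inner` conjugates its first argument. -/
lemma memLp_conj_leftFactor (hθ : StrictMono θ)
    (hθr : ∀ j, θ j ∈ Ico 0 (2 * Real.pi)) (hβ : ∀ j, 0 < β j) (hε : ε ∈ Ioo (0 : ℝ) 1)
    (hM : 0 < M) (P : ℂ[X]) (j : Fin k) :
    MemLp (fun q => conj (leftFactor p a θ β ε M P j q)) 2 (contourMeasure θ ε j) := by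
  have h := memLp_leftFactor (p := p) (a := a) hθ hθr hβ hε hM P j
  exact h.of_le (Complex.continuous_conj.comp_aestronglyMeasurable h.1)
    (ae_of_all _ fun q => by rw [RCLike.norm_conj])

lemma kernel_eq {φ : ℕ → ℂ[X]} (hβ : ∀ j, 0 < β j)
    (hφ : IsOrthonormalPolys (symbol p a θ β) φ) {N : ℕ} {l : Fin k} {z w : ℝ × ℝ}
    (hz : 0 < z.1) (hw : 0 < w.1) (hzw : polar z ≠ polar w) :
    kernel θ ε N M (symbolExt p a θ β) φ j l z w * orientation θ ε j z =
      ∑ m : Fin N, leftFactor p a θ β ε M (φ m) j z * rightFactor p a θ β ε M (φ m) l w := by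
  rw [kernel, christoffelDarboux (continuous_symbol_exp hβ) hφ (polar_ne_zero hz)
    (polar_ne_zero hw) hzw, Finset.sum_range, Finset.mul_sum, Finset.sum_mul]
  refine Finset.sum_congr rfl fun m _ => ?_
  rw [leftFactor, rightFactor]
  ring

/-- The vector of `⊕_j L²(Γ_j)` with the given components. -/
noncomputable def contourVec {F : Fin k → ℝ × ℝ → ℂ}
    (hF : ∀ j, MemLp (F j) 2 (contourMeasure θ ε j)) : ContourSpace θ ε :=
  WithLp.toLp 2 fun j => (hF j).toLp (F j)

lemma coeFn_contourVec {F : Fin k → ℝ × ℝ → ℂ}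
    (hF : ∀ j, MemLp (F j) 2 (contourMeasure θ ε j)) (j : Fin k) :
    (contourVec hF j : ℝ × ℝ → ℂ) =ᵐ[contourMeasure θ ε j] F j :=
  (hF j).coeFn_toLp

lemma inner_contourVec_conj {F : Fin k → ℝ × ℝ → ℂ}
    (hF : ∀ j, MemLp (fun q => conj (F j q)) 2 (contourMeasure θ ε j)) (h : ContourSpace θ ε) :
    inner ℂ (contourVec hF) h =
      ∑ j, ∫ q, F j q * (h j : ℝ × ℝ → ℂ) q ∂contourMeasure θ ε j := by
  rw [PiLp.inner_apply]
  refine Finset.sum_congr rfl fun j _ => ?_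
  rw [L2.inner_def]
  refine integral_congr_ae ?_
  filter_upwards [coeFn_contourVec hF j] with q hq
  rw [RCLike.inner_apply, hq, Complex.conj_conj, mul_comm]

lemma coeFn_sum_smul {ι : Type*} (s : Finset ι) (c : ι → ℂ) (y : ι → ContourSpace θ ε)
    (l : Fin k) : ((∑ m ∈ s, c m • y m : ContourSpace θ ε) l : ℝ × ℝ → ℂ)
      =ᵐ[contourMeasure θ ε l] fun w => ∑ m ∈ s, c m * (y m l : ℝ × ℝ → ℂ) w := by
  classical
  induction s using Finset.induction_on with
  | empty =>
    simp only [Finset.sum_empty, PiLp.zero_apply]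
    exact Lp.coeFn_zero _ _ _
  | insert i s hi ih =>
    rw [Finset.sum_insert hi, PiLp.add_apply, PiLp.smul_apply]
    filter_upwards [Lp.coeFn_add (c i • y i l) ((∑ m ∈ s, c m • y m : ContourSpace θ ε) l),
      Lp.coeFn_smul (c i) (y i l), ih] with w h1 h2 h3
    rw [h1, Pi.add_apply, h2, h3, Finset.sum_insert hi, Pi.smul_apply, smul_eq_mul]

theorem isContourIntegralOperator_finiteRankOp (hθ : StrictMono θ)
    (hθr : ∀ j, θ j ∈ Ico 0 (2 * Real.pi)) (hβ : ∀ j, 0 < β j) (hε : ε ∈ Ioo (0 : ℝ) 1)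
    (hM : 0 < M) {φ : ℕ → ℂ[X]} (hφ : IsOrthonormalPolys (symbol p a θ β) φ) (N : ℕ) :
    IsContourIntegralOperator θ ε (kernel θ ε N M (symbolExt p a θ β) φ)
      (finiteRankOp
        (fun m : Fin N => contourVec (memLp_conj_leftFactor (p := p) (a := a) hθ hθr hβ hε hM (φ m)))
        fun m : Fin N =>
          contourVec (memLp_rightFactor (p := p) (a := a) hθ hθr hβ hε hM (φ m))) := by
  intro h l
  have hint : ∀ (m : Fin N) (j : Fin k), Integrable
      (fun z => leftFactor p a θ β ε M (φ m) j z * (h j : ℝ × ℝ → ℂ) z) (contourMeasure θ ε j) :=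
    fun m j => (memLp_leftFactor hθ hθr hβ hε hM (φ m) j).integrable_mul (Lp.memLp (h j))
  have hright : ∀ᵐ w ∂contourMeasure θ ε l, ∀ m : Fin N,
      (contourVec (memLp_rightFactor (p := p) (a := a) hθ hθr hβ hε hM (φ m)) l :
        ℝ × ℝ → ℂ) w = rightFactor p a θ β ε M (φ m) l w :=
    ae_all_iff.2 fun m => coeFn_contourVec _ l
  rw [finiteRankOp_apply]
  filter_upwards [coeFn_sum_smul (Finset.univ : Finset (Fin N)) _ _ l, hright, ae_fst_pos (j := l) hθ hθr hε]
    with w hw1 hw2 hw3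
  -- Here `w` is fixed, and the null set of excluded `z` depends on it. The kernel becomes a finite
  -- sum of products, each an `L²` function of `z` times a constant, so the integrals against `h`
  -- converge absolutely.
  have hker : ∀ j, (fun z => kernel θ ε N M (symbolExt p a θ β) φ j l z w *
      (h j : ℝ × ℝ → ℂ) z * orientation θ ε j z) =ᵐ[contourMeasure θ ε j]
      fun z => ∑ m : Fin N, leftFactor p a θ β ε M (φ m) j z * (h j : ℝ × ℝ → ℂ) z *
        rightFactor p a θ β ε M (φ m) l w := by
    intro j
    filter_upwards [ae_fst_pos (j := j) hθ hθr hε, ae_polar_ne hε (polar w)] with z hz1 hz2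
    rw [mul_right_comm, kernel_eq hβ hφ hz1 hw3 hz2, Finset.sum_mul]
    exact Finset.sum_congr rfl fun m _ => by ring
  refine ⟨fun j => ?_, ?_⟩
  · exact (integrable_finsetSum _ fun m _ => (hint m j).mul_const _).congr (hker j).symm
  · rw [hw1]
    simp_rw [hw2, inner_contourVec_conj, Finset.sum_mul]
    rw [Finset.sum_comm]
    refine Finset.sum_congr rfl fun j _ => ?_
    rw [integral_congr_ae (hker j), integral_finsetSum _ fun m _ => (hint m j).mul_const _]
    simp_rw [integral_mul_const]

/-- The two square roots multiply to `v f`, and what remains is `g(z) = Q(z) conjPoly P (1/z)`,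
holomorphic off `0` and equal to `Q conj(P)` on the circle. So `sum_integral_discWeight` applies. -/
theorem inner_leftFactor_rightFactor (hk : 0 < k) (hθ : StrictMono θ)
    (hθr : ∀ j, θ j ∈ Ico 0 (2 * Real.pi)) (hβ : ∀ j, 0 < β j) (hε : ε ∈ Ioo (0 : ℝ) 1)
    (hM : 0 < M) (P Q : ℂ[X]) :
    inner ℂ (contourVec (memLp_conj_leftFactor (p := p) (a := a) hθ hθr hβ hε hM P))
      (contourVec (memLp_rightFactor (p := p) (a := a) hθ hθr hβ hε hM Q)) =
    discreteMean M (fun z => Q.eval z * conj (P.eval z) * symbol p a θ β z) -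
      circleMean (fun z => Q.eval z * conj (P.eval z) * symbol p a θ β z) := by
  have hg : ∀ z ≠ 0, DifferentiableAt ℂ (fun z => Q.eval z * (conjPoly P).eval z⁻¹) z :=
    fun z hz => Q.differentiable.differentiableAt.mul (differentiableAt_conjPoly_inv P z hz)
  have hcircle : ∀ z : ℂ, ‖z‖ = 1 → Q.eval z * (conjPoly P).eval z⁻¹ * symbol p a θ β z =
      Q.eval z * conj (P.eval z) * symbol p a θ β z := by
    intro z hz
    rw [eval_conjPoly, inv_eq_conj_of_norm hz, Complex.conj_conj]
  have hres := sum_integral_discWeight (p := p) (a := a) hk hθ hθr hβ hε hg hM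
  have hd : discreteMean M (fun z => Q.eval z * (conjPoly P).eval z⁻¹ * symbol p a θ β z) =
      discreteMean M (fun z => Q.eval z * conj (P.eval z) * symbol p a θ β z) := by
    unfold discreteMean
    congr 1
    exact Finset.sum_congr rfl fun z hz => hcircle z (norm_eq_one_of_mem_nthRootsFinset hM hz)
  have hc : circleMean (fun z => Q.eval z * (conjPoly P).eval z⁻¹ * symbol p a θ β z) =
      circleMean (fun z => Q.eval z * conj (P.eval z) * symbol p a θ β z) :=
    circleMean_congr fun t => hcircle _ (norm_exp_mul_I t)
  rw [hd, hc] at hres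
  rw [inner_contourVec_conj, ← hres]
  refine Finset.sum_congr rfl fun j _ => integral_congr_ae ?_
  filter_upwards [coeFn_contourVec
    (memLp_rightFactor (p := p) (a := a) hθ hθr hβ hε hM Q) j] with q hq
  rw [hq, leftFactor, rightFactor, contourIntegrand]
  linear_combination arcFactor ε q * orientation θ ε j q * (conjPoly P).eval (polar q)⁻¹ *
    Q.eval (polar q) * sqrtWeight_mul_self (θ := θ) (ε := ε) (M := M) (j := j)
      (symbolExt p a θ β) q

end Operator

end DiscreteToeplitz

theorem mainTheorem5 (k : ℕ) (hk : 0 < k) (p : ℕ) (a : ℕ → ℂ)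
    (θ β : Fin k → ℝ) (hθ : StrictMono θ) (hθ_range : ∀ j, θ j ∈ Set.Ico 0 (2 * Real.pi))
    (hβ : ∀ j, 0 < β j) (ε : ℝ) (hε : ε ∈ Set.Ioo (0 : ℝ) 1)
    (N M : ℕ) (hN : 0 < N) (hM : 0 < M) :
    (∃ φ : ℕ → Polynomial ℂ,
      DiscreteToeplitz.IsOrthonormalPolys (DiscreteToeplitz.symbol p a θ β) φ) ∧
    ∀ φ : ℕ → Polynomial ℂ,
      DiscreteToeplitz.IsOrthonormalPolys (DiscreteToeplitz.symbol p a θ β) φ →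
      ∃ K : DiscreteToeplitz.ContourSpace θ ε →L[ℂ] DiscreteToeplitz.ContourSpace θ ε,
        DiscreteToeplitz.IsContourIntegralOperator θ ε
          (DiscreteToeplitz.kernel θ ε N M (DiscreteToeplitz.symbolExt p a θ β) φ) K ∧
        FiniteDimensional ℂ (LinearMap.range (K : DiscreteToeplitz.ContourSpace θ ε →ₗ[ℂ]
          DiscreteToeplitz.ContourSpace θ ε)) ∧
        DiscreteToeplitz.IsTraceClass K ∧
        DiscreteToeplitz.HasFredholmDet K (DiscreteToeplitz.fredholmDet K) ∧
        DiscreteToeplitz.discreteToeplitz N M (DiscreteToeplitz.symbol p a θ β) =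
          DiscreteToeplitz.toeplitz N (DiscreteToeplitz.symbol p a θ β) *
            DiscreteToeplitz.fredholmDet K := by
  open DiscreteToeplitz in
  refine ⟨exists_isOrthonormalPolys symbol_exp (continuous_realSymbol hβ) realSymbol_nonneg
    (Set.finite_range (sing θ)) fun t ht => exp_mem_of_realSymbol_eq_zero ht, fun φ hφ => ?_⟩
  refine ⟨_, isContourIntegralOperator_finiteRankOp hθ hθ_range hβ hε hM hφ N,
    finiteDimensional_range_finiteRankOp _ _, isTraceClass_finiteRankOp _ _, ?_, ?_⟩
  · rw [fredholmDet_finiteRankOp]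
    exact hasFredholmDet_finiteRankOp _ _
  · rw [discreteToeplitz_eq_toeplitz_mul (continuous_symbol_exp hβ) hφ hM,
      fredholmDet_finiteRankOp]
    -- It remains to compare matrix entries: the identity matrix cancels the subtracted continuous
    -- Gram matrix of the orthonormal `φ_m`.
    congr 2
    ext m n
    rw [Matrix.add_apply, Matrix.of_apply, Matrix.of_apply,
      inner_leftFactor_rightFactor hk hθ hθ_range hβ hε hM, hφ.2, Matrix.one_apply]
    simp [Fin.ext_iff, eq_comm]
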